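/- Let $d\ge 2$, let $\Omega\subset\mathbb R^d$ be a bounded domain with Lipschitz boundary, let $\Omega_1$ be a nonempty open set with $\overline{\Omega_1}\subset\Omega$ such that $\Gamma:=\partial\Omega_1$ is Lipschitz and $\Omega_2:=\Omega\setminus\overline{\Omega_1}$ is connected. Let $\sigma=\sigma_1\chi_{\Omega_1}+\sigma_2\chi_{\Omega_2}$ with constants $\sigma_1,\sigma_2>0$, and let $L^\infty_+(\Gamma)$ be the set of functions in $L^\infty(\Gamma)$ with positive essential infimum. For $\gamma\in L^\infty_+(\Gamma)$ and $g\in L^2(\partial\Omega)$, let $u=u_\gamma^{g}\in H^1(\Omega)$ be the solution of the transmission problem $-\operatorname{div}(\sigma\nabla u)=0$ in $\Omega_1\cup\Omega_2$, $\sigma_2\partial_\nu u=g$ on $\partial\Omega$, with the jump conditions $[u]=0$ and $[\sigma\partial_\nu u]=\gamma u$ on $\Gamma$, that is, of $$\int_\Omega\sigma\nabla u\cdot\nabla w\,dx+\int_\Gamma\gamma uw\,ds=\int_{\partial\Omega}gw\,ds\qquad\text{for all }w\in H^1(\Omega),$$ and let $\Lambda(\gamma):L^2(\partial\Omega)\to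 L^2(\partial\Omega)$, $g\mapsto u_\gamma^{g}|_{\partial\Omega}$, be the Neumann-to-Dirichlet map. (i) For all $\gamma_1,\gamma_2\in L^\infty_+(\Gamma)$ and $g\in L^2(\partial\Omega)$, the solution $u_2:=u_{\gamma_2}^{g}$ satisfies $$\int_\Gamma(\gamma_1-\gamma_2)u_2^2\,ds\;\ge\;\int_{\partial\Omega}g\,(\Lambda(\gamma_2)-\Lambda(\gamma_1))g\,ds\;\ge\;\int_\Gamma\Big(\gamma_2-\frac{\gamma_2^2}{\gamma_1}\Big)u_2^2\,ds .$$ (ii) Consequently, if $\gamma_1,\gamma_2\in L^\infty_+(\Gamma)$ and $\gamma_1\le\gamma_2$ almost everywhere on $\Gamma$, then $\Lambda(\gamma_1)\ge\Lambda(\gamma_2)$ in the sense of quadratic forms, i.e. $\int_{\partial\Omega}g\,\Lambda(\gamma_1)g\,ds\ge\int_{\partial\Omega}g\,\Lambda(\gamma_2)g\,ds$ for all $g\in L^2(\partial\Omega)$. -/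

import Mathlib

open MeasureTheory Filter Topology
open scoped ENNReal ContDiff

/-- Surface measure `ds` on a set `S` in `d`-dimensional Euclidean space: the `(d-1)`-dimensional
Hausdorff measure, normalised to agree with Lebesgue measure on hyperplanes, restricted to `S`. -/
noncomputable def surfaceMeasure {d : ℕ} (S : Set (EuclideanSpace ℝ (Fin d))) :
    Measure (EuclideanSpace ℝ (Fin d)) :=
  (μHE[d - 1] : Measure (EuclideanSpace ℝ (Fin d))).restrict S

/-- The boundary of `U` is Lipschitz: near every boundary point, in suitable rigid Cartesian
coordinates `(y', y_d)`, the set `U` is the strict epigraph `y_d > f y'` of a Lipschitz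
function `f`. -/
def HasLipschitzBoundary {d : ℕ} (U : Set (EuclideanSpace ℝ (Fin d))) : Prop :=
  ∀ x ∈ frontier U, ∃ N ∈ 𝓝 x,
    ∃ T : EuclideanSpace ℝ (Fin d) ≃ₗᵢ[ℝ] WithLp 2 (EuclideanSpace ℝ (Fin (d - 1)) × ℝ),
    ∃ f : EuclideanSpace ℝ (Fin (d - 1)) → ℝ, (∃ K, LipschitzWith K f) ∧
      ∀ y ∈ N, y ∈ U ↔ f (T y).fst < (T y).snd

/-- `G` is the weak gradient of `u` in the open set `U`. -/
def IsWeakGradient {d : ℕ} (U : Set (EuclideanSpace ℝ (Fin d)))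
    (u : EuclideanSpace ℝ (Fin d) → ℝ)
    (G : EuclideanSpace ℝ (Fin d) → EuclideanSpace ℝ (Fin d)) : Prop :=
  ∀ φ : EuclideanSpace ℝ (Fin d) → ℝ, ContDiff ℝ ∞ φ → HasCompactSupport φ → tsupport φ ⊆ U →
    ∫ x in U, u x • gradient φ x = - ∫ x in U, φ x • G x

/-- The Sobolev space `H¹(U)`: a function in `L²(U)` together with its (unique) weak gradient,
which lies in `L²(U)` as well. -/
structure SobolevH1 {d : ℕ} (U : Set (EuclideanSpace ℝ (Fin d))) where
  /-- the function itself -/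
  val : Lp ℝ 2 (volume.restrict U)
  /-- its weak gradient -/
  grad : Lp (EuclideanSpace ℝ (Fin d)) 2 (volume.restrict U)
  isWeakGradient : IsWeakGradient U val grad

/-- `t` is the (Dirichlet) trace on `S` of `u ∈ H¹(U)`, where `S ⊆ closure U`: some smooth functions
converge to `u` in `H¹(U)` while their restrictions to `S` converge to `t` in `L²(S)`. This is the
graph of the trace operator, the continuous extension to `H¹(U)` of the restriction map
`φ ↦ φ|_S` for functions `φ` that are smooth up to the boundary. -/
def HasTrace {d : ℕ} {U : Set (EuclideanSpace ℝ (Fin d))} (S : Set (EuclideanSpace ℝ (Fin d)))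
    (u : SobolevH1 U) (t : Lp ℝ 2 (surfaceMeasure S)) : Prop :=
  ∃ φ : ℕ → EuclideanSpace ℝ (Fin d) → ℝ, (∀ n, ContDiff ℝ ∞ (φ n)) ∧
    Tendsto (fun n => eLpNorm (fun x => φ n x - u.val x) 2 (volume.restrict U)) atTop (𝓝 0) ∧
    Tendsto (fun n => eLpNorm (fun x => gradient (φ n) x - u.grad x) 2 (volume.restrict U))
      atTop (𝓝 0) ∧
    Tendsto (fun n => eLpNorm (fun x => φ n x - t x) 2 (surfaceMeasure S)) atTop (𝓝 0)

/-- `L^∞_+(S)`: the functions in `L^∞(S)` with positive essential infimum. -/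
def LInftyPos {d : ℕ} (S : Set (EuclideanSpace ℝ (Fin d))) :
    Set (Lp ℝ ∞ (surfaceMeasure S)) :=
  {γ | ∃ c : ℝ, 0 < c ∧ ∀ᵐ x ∂surfaceMeasure S, c ≤ γ x}

/-- The conductivity `σ₁ χ_{Ω₁} + σ₂ χ_{Ω₂}` with `Ω₂ = Ω \ closure Ω₁`. -/
noncomputable def conductivity {d : ℕ} (Ω Ω₁ : Set (EuclideanSpace ℝ (Fin d))) (σ₁ σ₂ : ℝ)
    (x : EuclideanSpace ℝ (Fin d)) : ℝ :=
  Ω₁.indicator (fun _ => σ₁) x + (Ω \ closure Ω₁).indicator (fun _ => σ₂) x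

/-- `u ∈ H¹(Ω)` solves the Robin transmission problem with Robin parameter `γ` on `Γ = ∂Ω₁` and
Neumann data `g` on `∂Ω`, in its variational form
`∫_Ω σ ∇u · ∇w dx + ∫_Γ γ u w ds = ∫_{∂Ω} g w ds` for all `w ∈ H¹(Ω)`. -/
def IsRobinSolution {d : ℕ} (Ω Ω₁ : Set (EuclideanSpace ℝ (Fin d))) (σ₁ σ₂ : ℝ)
    (γ : Lp ℝ ∞ (surfaceMeasure (frontier Ω₁))) (g : Lp ℝ 2 (surfaceMeasure (frontier Ω)))
    (u : SobolevH1 Ω) : Prop :=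
  ∃ uΓ : Lp ℝ 2 (surfaceMeasure (frontier Ω₁)), HasTrace (frontier Ω₁) u uΓ ∧
    ∀ (w : SobolevH1 Ω) (wΓ : Lp ℝ 2 (surfaceMeasure (frontier Ω₁)))
      (wb : Lp ℝ 2 (surfaceMeasure (frontier Ω))),
      HasTrace (frontier Ω₁) w wΓ → HasTrace (frontier Ω) w wb →
      (∫ x in Ω, conductivity Ω Ω₁ σ₁ σ₂ x * inner ℝ (u.grad x) (w.grad x))
        + ∫ x, γ x * uΓ x * wΓ x ∂surfaceMeasure (frontier Ω₁)
      = ∫ x, g x * wb x ∂surfaceMeasure (frontier Ω)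

open Classical in
/-- The Neumann-to-Dirichlet map `Λ(γ) : L²(∂Ω) → L²(∂Ω)`, `g ↦ u|_{∂Ω}` with `u` the solution of
the Robin transmission problem. (The problem being well-posed for `γ ∈ L^∞_+(Γ)`, the default value
is never taken for such `γ` and the choice is unique.) -/
noncomputable def neumannToDirichlet {d : ℕ} (Ω Ω₁ : Set (EuclideanSpace ℝ (Fin d)))
    (σ₁ σ₂ : ℝ) (γ : Lp ℝ ∞ (surfaceMeasure (frontier Ω₁)))
    (g : Lp ℝ 2 (surfaceMeasure (frontier Ω))) : Lp ℝ 2 (surfaceMeasure (frontier Ω)) :=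
  if h : ∃ t : Lp ℝ 2 (surfaceMeasure (frontier Ω)), ∃ u : SobolevH1 Ω,
      IsRobinSolution Ω Ω₁ σ₁ σ₂ γ g u ∧ HasTrace (frontier Ω) u t
  then h.choose else 0

/-!
The Neumann-to-Dirichlet form is compared through the energies of the two Robin problems. Write
`a_j(u, w) = ∫_Ω σ ∇u·∇w + ∫_Γ γ_j u w` and let `u_j` solve the problem for `γ_j` with the same
datum `g`. Testing each problem with both solutions gives `∫ g Λ(γ₂)g = a₂(u₂,u₂) = a₁(u₁,u₂)` and
`∫ g Λ(γ₁)g = a₁(u₁,u₁) = a₂(u₂,u₁)`. Hence the difference of the two sides of the upper bound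
is `a₁(u₂ - u₁, u₂ - u₁) ≥ 0`, and the difference of the two sides of the lower bound is
`∫_Ω σ|∇(u₂ - u₁)|² + ∫_Γ γ₁ (u₁ - (γ₂/γ₁) u₂)² ≥ 0` (`weightedForm_sub_sub`,
`integral_sub_sq_div_mul_sq_le`). Part (ii) follows from the upper bound.

This presupposes that the problems are well posed, since `neumannToDirichlet` is defined by a choice
with a default value. Two inequalities for functions `φ` smooth on the whole space are needed.

* The trace inequality `∫_{∂U} φ² ≤ C ∫_U (φ² + |∇φ|²)` for a bounded Lipschitz domain
  (`HasLipschitzBoundary.exists_lintegral_frontier_le`). In a boundary chart it is the fundamental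
  theorem of calculus along the chart direction, since the surface measure of a Lipschitz graph is
  at most a multiple of the Lebesgue measure of its base; compactness of `∂U` does the rest.
* The Poincaré inequality `∫_Ω φ² ≤ C (∫_Ω |∇φ|² + ∫_Γ φ²)`
  (`energyControlled_surfaceMeasure_frontier`). The same chart argument on `Γ` bounds `φ` on one
  ball. Translating balls inside the connected set `Ω` spreads the bound to a ball around each point
  of `Ω`, and translating into `Ω` along the chart direction covers a neighbourhood of each boundary
  point.

No density theorem for Sobolev functions enters: `HasTrace` itself provides the smooth
approximations. By the trace inequality all quadruples `(u, ∇u, u|_Γ, u|_∂Ω)` of a function and its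
traces lie in the closure of the smooth ones in a Hilbert space, where the Poincaré inequality makes
`a_j` coercive and the Lax–Milgram theorem applies (`exists_isRobinSolution`).
-/

/-! ### Integral inequalities along segments -/

section Segments

theorem ENNReal.add_sq_le_two_mul (a b : ℝ≥0∞) : (a + b) ^ 2 ≤ 2 * a ^ 2 + 2 * b ^ 2 := by
  rcases eq_or_ne a ⊤ with rfl | ha
  · simp
  rcases eq_or_ne b ⊤ with rfl | hb
  · simp
  lift a to NNReal using ha
  lift b to NNReal using hb
  rw [← mul_add]
  exact_mod_cast add_sq_le (a := a) (b := b)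

theorem sq_lintegral_le {α : Type*} [MeasurableSpace α] (μ : Measure α) {f : α → ℝ≥0∞}
    (hf : AEMeasurable f μ) : (∫⁻ x, f x ∂μ) ^ 2 ≤ μ Set.univ * ∫⁻ x, f x ^ 2 ∂μ := by
  have h := ENNReal.lintegral_mul_le_Lp_mul_Lq μ Real.HolderConjugate.two_two hf
    (aemeasurable_const (b := (1 : ℝ≥0∞)))
  simp only [Pi.mul_apply, mul_one, lintegral_const, ENNReal.rpow_ofNat, one_pow, one_mul] at h
  calc (∫⁻ x, f x ∂μ) ^ 2
      ≤ ((∫⁻ x, f x ^ 2 ∂μ) ^ (1 / 2 : ℝ) * μ Set.univ ^ (1 / 2 : ℝ)) ^ 2 := by gcongr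
    _ = μ Set.univ * ∫⁻ x, f x ^ 2 ∂μ := by
        rw [mul_pow, ← ENNReal.rpow_two, ← ENNReal.rpow_two, ← ENNReal.rpow_mul,
          ← ENNReal.rpow_mul]
        norm_num [mul_comm]

variable {E : Type*} [NormedAddCommGroup E] [InnerProductSpace ℝ E] [CompleteSpace E]

theorem norm_gradient (φ : E → ℝ) (x : E) : ‖gradient φ x‖ = ‖fderiv ℝ φ x‖ := by
  simp [gradient]

theorem ContDiff.continuous_gradient {φ : E → ℝ} (hφ : ContDiff ℝ 1 φ) :
    Continuous (gradient φ) :=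
  (InnerProductSpace.toDual ℝ E).symm.continuous.comp (hφ.continuous_fderiv (by simp))

/-- The fundamental theorem of calculus along a segment, squared by the Cauchy–Schwarz
inequality. -/
theorem enorm_sub_sq_le_lintegral_gradient {φ : E → ℝ} (hφ : ContDiff ℝ 1 φ) (x v : E) {s : ℝ}
    (hs : 0 ≤ s) :
    ‖φ (x + s • v) - φ x‖ₑ ^ 2 ≤
      ENNReal.ofReal s * (‖v‖ₑ ^ 2 * ∫⁻ τ in Set.Ioc 0 s, ‖gradient φ (x + τ • v)‖ₑ ^ 2) := by
  have hd : ∀ τ ∈ Set.uIcc 0 s,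
      HasDerivAt (fun τ : ℝ => φ (x + τ • v)) (fderiv ℝ φ (x + τ • v) v) τ := by
    intro τ _
    have h1 : HasDerivAt (fun τ : ℝ => x + τ • v) v τ := by
      simpa using ((hasDerivAt_id τ).smul_const v).const_add x
    exact ((hφ.differentiable (by simp)) (x + τ • v)).hasFDerivAt.comp_hasDerivAt τ h1
  have hline : Continuous fun τ : ℝ => x + τ • v := by fun_prop
  have hc : Continuous fun τ : ℝ => fderiv ℝ φ (x + τ • v) v :=
    ((hφ.continuous_fderiv (by simp)).comp hline).clm_apply continuous_const
  have hg : Continuous fun τ : ℝ => gradient φ (x + τ • v) := hφ.continuous_gradient.comp hline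
  have h := intervalIntegral.integral_eq_sub_of_hasDerivAt hd (hc.intervalIntegrable _ _)
  simp only [zero_smul, add_zero] at h
  rw [← h, intervalIntegral.integral_of_le hs]
  calc ‖∫ τ in Set.Ioc 0 s, fderiv ℝ φ (x + τ • v) v‖ₑ ^ 2
      ≤ (∫⁻ τ in Set.Ioc 0 s, ‖v‖ₑ * ‖gradient φ (x + τ • v)‖ₑ) ^ 2 := by
        gcongr
        refine (enorm_integral_le_lintegral_enorm _).trans (lintegral_mono fun τ => ?_)
        rw [← enorm_norm v, ← enorm_norm (gradient φ _), ← enorm_mul, norm_gradient,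
          ← enorm_norm (fderiv ℝ φ _ v)]
        simp only [enorm_mul, enorm_norm]
        rw [mul_comm]
        exact ContinuousLinearMap.le_opENorm _ _
    _ ≤ _ := by
        refine (sq_lintegral_le _ ?_).trans ?_
        · exact hg.enorm.measurable.aemeasurable.const_mul _
        · simp only [Measure.restrict_apply, MeasurableSet.univ, Set.univ_inter,
            Real.volume_Ioc, sub_zero, mul_pow]
          rw [lintegral_const_mul' _ _ (by simp)]

theorem enorm_sq_le_add_lintegral_gradient {φ : E → ℝ} (hφ : ContDiff ℝ 1 φ) (x v : E) {s : ℝ}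
    (hs : 0 ≤ s) :
    ‖φ x‖ₑ ^ 2 ≤ 2 * ‖φ (x + s • v)‖ₑ ^ 2 + 2 * (ENNReal.ofReal s *
      (‖v‖ₑ ^ 2 * ∫⁻ τ in Set.Ioc 0 s, ‖gradient φ (x + τ • v)‖ₑ ^ 2)) := by
  calc ‖φ x‖ₑ ^ 2 = ‖φ (x + s • v) - (φ (x + s • v) - φ x)‖ₑ ^ 2 := by congr 2; ring
    _ ≤ (‖φ (x + s • v)‖ₑ + ‖φ (x + s • v) - φ x‖ₑ) ^ 2 := by gcongr; exact enorm_sub_le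
    _ ≤ _ := ENNReal.add_sq_le_two_mul _ _
    _ ≤ _ := by gcongr; exact enorm_sub_sq_le_lintegral_gradient hφ x v hs

theorem enorm_sq_add_le_add_lintegral_gradient {φ : E → ℝ} (hφ : ContDiff ℝ 1 φ) (x v : E) {s : ℝ}
    (hs : 0 ≤ s) :
    ‖φ (x + s • v)‖ₑ ^ 2 ≤ 2 * ‖φ x‖ₑ ^ 2 + 2 * (ENNReal.ofReal s *
      (‖v‖ₑ ^ 2 * ∫⁻ τ in Set.Ioc 0 s, ‖gradient φ (x + τ • v)‖ₑ ^ 2)) := by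
  calc ‖φ (x + s • v)‖ₑ ^ 2 = ‖φ x + (φ (x + s • v) - φ x)‖ₑ ^ 2 := by congr 2; ring
    _ ≤ (‖φ x‖ₑ + ‖φ (x + s • v) - φ x‖ₑ) ^ 2 := by gcongr; exact enorm_add_le _ _
    _ ≤ _ := ENNReal.add_sq_le_two_mul _ _
    _ ≤ _ := by gcongr; exact enorm_sub_sq_le_lintegral_gradient hφ x v hs

/-- Comparison of `φ` on `A` and on the translate `A + v`, when the tube swept out by `A` stays
in `U`. -/
theorem lintegral_enorm_sq_le_translate [MeasurableSpace E] [BorelSpace E] {μ : Measure E}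
    [SecondCountableTopology E]
    [μ.IsAddRightInvariant] [SFinite μ] {A U B : Set E} (hU : MeasurableSet U)
    (hB : MeasurableSet B) {v : E}
    (hAU : ∀ x ∈ A, ∀ t ∈ Set.Icc (0 : ℝ) 1, x + t • v ∈ U) (hAB : ∀ x ∈ A, x + v ∈ B)
    {φ : E → ℝ} (hφ : ContDiff ℝ 1 φ) :
    ∫⁻ x in A, ‖φ x‖ₑ ^ 2 ∂μ ≤
      2 * ∫⁻ x in B, ‖φ x‖ₑ ^ 2 ∂μ + 2 * (‖v‖ₑ ^ 2 * ∫⁻ x in U, ‖gradient φ x‖ₑ ^ 2 ∂μ) := by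
  have hmφ : Measurable fun x => ‖φ x‖ₑ ^ 2 := (hφ.continuous.measurable.enorm).pow_const 2
  have hmg : Measurable fun x => ‖gradient φ x‖ₑ ^ 2 :=
    hφ.continuous_gradient.measurable.enorm.pow_const 2
  have key : ∀ (w : E) (C : Set E) (f : E → ℝ≥0∞), MeasurableSet C → Measurable f →
      (∀ x ∈ A, x + w ∈ C) → ∫⁻ x in A, f (x + w) ∂μ ≤ ∫⁻ x in C, f x ∂μ := by
    intro w C f hC hf hAC
    rw [← (measurePreserving_add_right μ w).setLIntegral_comp_preimage hC hf]
    exact lintegral_mono_set hAC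
  calc ∫⁻ x in A, ‖φ x‖ₑ ^ 2 ∂μ
      ≤ ∫⁻ x in A, (2 * ‖φ (x + v)‖ₑ ^ 2 +
          2 * (‖v‖ₑ ^ 2 * ∫⁻ t in Set.Ioc (0 : ℝ) 1, ‖gradient φ (x + t • v)‖ₑ ^ 2)) ∂μ := by
        refine lintegral_mono fun x => ?_
        simpa using enorm_sq_le_add_lintegral_gradient hφ x v zero_le_one
    _ = 2 * ∫⁻ x in A, ‖φ (x + v)‖ₑ ^ 2 ∂μ + 2 * (‖v‖ₑ ^ 2 *
          ∫⁻ t in Set.Ioc (0 : ℝ) 1, ∫⁻ x in A, ‖gradient φ (x + t • v)‖ₑ ^ 2 ∂μ) := by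
        have hm : Measurable fun x => 2 * ‖φ (x + v)‖ₑ ^ 2 :=
          (hmφ.comp (measurable_add_const v)).const_mul 2
        rw [lintegral_add_left hm,
          lintegral_const_mul' _ _ (by simp), lintegral_const_mul' _ _ (by simp),
          lintegral_const_mul' _ _ (by simp), lintegral_lintegral_swap]
        refine Measurable.aemeasurable ?_
        exact hmg.comp (measurable_fst.add (measurable_snd.smul_const v))
    _ ≤ _ := by
        refine add_le_add (mul_le_mul_right (key v B _ hB hmφ hAB) _)
          (mul_le_mul_right (mul_le_mul_right ?_ _) _)
        calc _ ≤ ∫⁻ t in Set.Ioc (0 : ℝ) 1, ∫⁻ x in U, ‖gradient φ x‖ₑ ^ 2 ∂μ := by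
              refine setLIntegral_mono' measurableSet_Ioc fun t ht => ?_
              exact key (t • v) U _ hU hmg fun x hx => hAU x hx t ⟨ht.1.le, ht.2⟩
          _ = _ := by simp

end Segments

/-! ### Charts of a Lipschitz boundary -/

/-- A chart of the boundary of `U` near the boundary point `x₀`: the boundary is the range of a
Lipschitz graph map `G`, inverted by the projection `P`, and the points above the graph in the
direction `e` lie in `U`. All properties hold at the common scale `r`. -/
structure BoundaryChart {d : ℕ} (U : Set (EuclideanSpace ℝ (Fin d)))
    (x₀ : EuclideanSpace ℝ (Fin d)) where
  /-- the graph map `y ↦ (y, f y)` in the rotated coordinates -/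
  G : EuclideanSpace ℝ (Fin (d - 1)) → EuclideanSpace ℝ (Fin d)
  /-- the orthogonal projection to the base of the graph -/
  P : EuclideanSpace ℝ (Fin d) → EuclideanSpace ℝ (Fin (d - 1))
  /-- the unit vector pointing into `U`, in whose direction the graph is taken -/
  e : EuclideanSpace ℝ (Fin d)
  /-- a Lipschitz constant of the graph map -/
  K : NNReal
  /-- the scale of the chart -/
  r : ℝ
  r_pos : 0 < r
  lipschitz_G : LipschitzWith K G
  lipschitz_P : LipschitzWith 1 P
  P_G : ∀ y (s : ℝ), P (G y + s • e) = y
  norm_e : ‖e‖ = 1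
  G_center : G (P x₀) = x₀
  measurePreserving : MeasurePreserving
    (fun p : EuclideanSpace ℝ (Fin (d - 1)) × ℝ => G p.1 + p.2 • e) (volume.prod volume) volume
  G_mem : ∀ y ∈ Metric.ball (P x₀) r, G y ∈ frontier U
  above_mem : ∀ y ∈ Metric.ball (P x₀) r, ∀ s ∈ Set.Ioo 0 r, G y + s • e ∈ U
  frontier_subset : frontier U ∩ Metric.ball x₀ r ⊆ G '' Metric.ball (P x₀) r
  translate_mem : ∀ x ∈ U, x ∈ Metric.ball x₀ r → ∀ t : ℝ, 0 ≤ t → x + t • e ∈ Metric.ball x₀ r →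
    x + t • e ∈ U

/-- In the rotated coordinates `T` of the definition of a Lipschitz boundary, `G y` is the point
`(y, f y)` and `P` is the first coordinate. The vertical shear `(y, s) ↦ (y, f y + s)` preserves
volume by Fubini's theorem. -/
theorem HasLipschitzBoundary.exists_chart {d : ℕ} {U : Set (EuclideanSpace ℝ (Fin d))}
    (hU : IsOpen U) (hL : HasLipschitzBoundary U) {x₀ : EuclideanSpace ℝ (Fin d)}
    (hx₀ : x₀ ∈ frontier U) : Nonempty (BoundaryChart U x₀) := by
  obtain ⟨N, hN, T, f, ⟨K, hf⟩, hfN⟩ := hL x₀ hx₀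
  obtain ⟨R, hR, hRN⟩ := Metric.mem_nhds_iff.1 hN
  let P : EuclideanSpace ℝ (Fin d) → EuclideanSpace ℝ (Fin (d - 1)) := fun x => (T x).fst
  let G : EuclideanSpace ℝ (Fin (d - 1)) → EuclideanSpace ℝ (Fin d) :=
    fun y => T.symm (WithLp.toLp 2 (y, f y))
  let e : EuclideanSpace ℝ (Fin d) := T.symm (WithLp.toLp 2 (0, 1))
  have hTG : ∀ y (s : ℝ), T (G y + s • e) = WithLp.toLp 2 (y, f y + s) := by
    intro y s
    simp only [G, e, map_add, map_smul, LinearIsometryEquiv.apply_symm_apply]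
    rw [← WithLp.toLp_smul, ← WithLp.toLp_add]
    simp
  have hGT : ∀ x, f (T x).fst = (T x).snd → G (P x) = x := by
    intro x hx
    simp only [G, P, hx]
    exact T.symm_apply_apply x
  have hTe : ∀ x (s : ℝ),
      (T (x + s • e)).fst = (T x).fst ∧ (T (x + s • e)).snd = (T x).snd + s := by
    intro x s
    simp [e]
  have hne : ‖e‖ = 1 := by
    simp only [e, LinearIsometryEquiv.norm_map]
    simp
  have hGl : LipschitzWith (1 + K) G := by
    refine LipschitzWith.of_dist_le_mul fun y z => ?_
    rw [T.symm.dist_map]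
    have h1 : ‖WithLp.toLp 2 (y, f y) - WithLp.toLp 2 (z, f z)‖ ≤ ‖y - z‖ + ‖f y - f z‖ := by
      rw [← WithLp.toLp_sub]
      refine abs_le_of_sq_le_sq' ?_ (by positivity) |>.2
      rw [WithLp.prod_norm_sq_eq_of_L2]
      change ‖y - z‖ ^ 2 + ‖f y - f z‖ ^ 2 ≤ _
      nlinarith [norm_nonneg (y - z), norm_nonneg (f y - f z),
        mul_nonneg (norm_nonneg (y - z)) (norm_nonneg (f y - f z))]
    have h2 := hf.dist_le_mul y z
    rw [dist_eq_norm, dist_eq_norm] at *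
    push_cast
    linarith
  have hPl : LipschitzWith 1 P := by
    refine LipschitzWith.of_dist_le_mul fun x z => ?_
    rw [dist_eq_norm, dist_eq_norm]
    have : P x - P z = (T (x - z)).fst := by simp [P]
    rw [this, NNReal.coe_one, one_mul, ← T.norm_map (x - z)]
    refine abs_le_of_sq_le_sq' ?_ (norm_nonneg _) |>.2
    rw [WithLp.prod_norm_sq_eq_of_L2]
    nlinarith [sq_nonneg ‖(T (x - z)).snd‖]
  have hmp : MeasurePreserving (fun p : EuclideanSpace ℝ (Fin (d - 1)) × ℝ => G p.1 + p.2 • e)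
      (volume.prod volume) volume := by
    have h1 : MeasurePreserving
        (fun p : EuclideanSpace ℝ (Fin (d - 1)) × ℝ => (id p.1, f p.1 + p.2))
        (volume.prod volume) (volume.prod volume) :=
      (MeasurePreserving.id volume).skew_product
        (g := fun (y : EuclideanSpace ℝ (Fin (d - 1))) (s : ℝ) => f y + s)
        (by have := hf.continuous; fun_prop)
        (Eventually.of_forall fun y => (measurePreserving_add_left volume (f y)).map_eq)
    have h2 := (WithLp.volume_preserving_toLp (EuclideanSpace ℝ (Fin (d - 1))) ℝ).comp h1
    have h3 := T.symm.measurePreserving.comp h2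
    have heq : (fun p : EuclideanSpace ℝ (Fin (d - 1)) × ℝ => G p.1 + p.2 • e) =
        T.symm ∘ WithLp.toLp 2 ∘ fun p => (id p.1, f p.1 + p.2) := by
      funext p
      simp only [Function.comp]
      rw [LinearIsometryEquiv.eq_symm_apply, hTG]
      rfl
    rw [heq]
    exact h3
  have hcT : Continuous fun x => (T x).snd :=
    (WithLp.prod_continuous_ofLp 2 _ _).snd.comp T.continuous
  have hcP : Continuous fun x => f (T x).fst := hf.continuous.comp hPl.continuous
  have hUN : ∀ x ∈ Metric.ball x₀ R, (x ∈ U ↔ f (T x).fst < (T x).snd) := fun x hx => hfN x (hRN hx)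
  have hfr : ∀ x ∈ Metric.ball x₀ R, x ∈ frontier U → f (T x).fst = (T x).snd := by
    intro x hx hxU
    rw [hU.frontier_eq] at hxU
    refine le_antisymm (le_of_not_gt fun hlt => ?_) (le_of_not_gt fun hlt => ?_)
    · have hopen : IsOpen (Metric.ball x₀ R ∩ {x | (T x).snd < f (T x).fst}) :=
        Metric.isOpen_ball.inter (isOpen_lt hcT hcP)
      obtain ⟨z, ⟨hz1, hz2⟩, hzU⟩ := mem_closure_iff.1 hxU.1 _ hopen ⟨hx, hlt⟩
      exact lt_asymm hz2 ((hUN z hz1).1 hzU)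
    · exact hxU.2 ((hUN x hx).2 hlt)
  have hx₀G : G (P x₀) = x₀ := hGT x₀ (hfr x₀ (Metric.mem_ball_self hR) hx₀)
  -- With this `r` the tube of radius and height `r` around `x₀` stays in `ball x₀ R`, as `1 + K` is
  -- a Lipschitz constant of `G`.
  set r : ℝ := R / (2 + K) with hr
  have hr0 : 0 < r := by positivity
  have hrR : (1 + K) * r + r = R := by rw [hr]; field_simp; ring
  have hrR' : r ≤ R := by nlinarith [K.2, mul_nonneg K.2 hr0.le]
  have hball : ∀ y ∈ Metric.ball (P x₀) r, ∀ s : ℝ, 0 ≤ s → s < r →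
      G y + s • e ∈ Metric.ball x₀ R := by
    intro y hy s hs0 hs
    rw [Metric.mem_ball, ← hrR]
    have h1 := hGl.dist_le_mul y (P x₀)
    rw [hx₀G] at h1
    calc dist (G y + s • e) x₀ ≤ dist (G y + s • e) (G y) + dist (G y) x₀ := dist_triangle _ _ _
      _ ≤ s + (1 + K) * dist y (P x₀) := by
          gcongr
          · simp [dist_eq_norm, norm_smul, hne, abs_of_nonneg hs0]
          · exact_mod_cast h1
      _ < r + (1 + K) * r := by
          have := Metric.mem_ball.1 hy
          have : (1 + K) * dist y (P x₀) ≤ (1 + K) * r := by gcongr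
          linarith
      _ = _ := add_comm _ _
  have habove : ∀ y ∈ Metric.ball (P x₀) r, ∀ s ∈ Set.Ioo 0 r, G y + s • e ∈ U := by
    intro y hy s hs
    rw [hUN _ (hball y hy s hs.1.le hs.2), hTG]
    simpa using hs.1
  refine ⟨⟨G, P, e, 1 + K, r, hr0, hGl, hPl, fun y s => ?_, hne, hx₀G, hmp, fun y hy => ?_,
    habove, ?_, ?_⟩⟩
  · change (T (G y + s • e)).fst = y
    rw [hTG]; rfl
  · rw [hU.frontier_eq]
    refine ⟨?_, fun hyU => ?_⟩
    · have ht : Tendsto (fun s : ℝ => G y + s • e) (𝓝[>] 0) (𝓝 (G y)) := by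
        have : Continuous fun s : ℝ => G y + s • e := by fun_prop
        simpa using (this.tendsto 0).mono_left nhdsWithin_le_nhds
      refine mem_closure_of_tendsto ht ?_
      filter_upwards [Ioo_mem_nhdsGT hr0] with s hs using habove y hy s hs
    · have h0 : G y ∈ Metric.ball x₀ R := by simpa using hball y hy 0 le_rfl hr0
      have h1 := (hUN _ h0).1 hyU
      have h2 := hTG y 0
      simp only [zero_smul, add_zero] at h2
      rw [h2] at h1
      exact lt_irrefl _ h1
  · rintro x ⟨hxU, hx⟩
    refine ⟨P x, ?_, hGT x (hfr x (Metric.ball_subset_ball hrR' hx) hxU)⟩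
    have := hPl.dist_le_mul x x₀
    rw [NNReal.coe_one, one_mul] at this
    exact lt_of_le_of_lt this hx
  · intro x hxU hx t ht hxt
    rw [hUN _ (Metric.ball_subset_ball hrR' hxt), (hTe x t).1, (hTe x t).2]
    have := (hUN x (Metric.ball_subset_ball hrR' hx)).1 hxU
    linarith

/-! ### Surface measure in a chart -/

theorem LipschitzWith.euclideanHausdorffMeasure_image_le {X Y : Type*} [EMetricSpace X]
    [MeasurableSpace X] [BorelSpace X] [EMetricSpace Y] [MeasurableSpace Y] [BorelSpace Y]
    {K : NNReal} {f : X → Y} (hf : LipschitzWith K f) (m : ℕ) (s : Set X) :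
    (μHE[m] : Measure Y) (f '' s) ≤ (K : ℝ≥0∞) ^ m * (μHE[m] : Measure X) s := by
  simp only [Measure.euclideanHausdorffMeasure_def, Measure.smul_apply, ENNReal.smul_def,
    smul_eq_mul]
  rw [mul_left_comm]
  gcongr
  simpa using hf.hausdorffMeasure_image_le (d := m) (Nat.cast_nonneg m) s

namespace BoundaryChart

variable {d : ℕ} {U : Set (EuclideanSpace ℝ (Fin d))} {x₀ : EuclideanSpace ℝ (Fin d)}
  (c : BoundaryChart U x₀)

theorem P_G_zero (y : EuclideanSpace ℝ (Fin (d - 1))) : c.P (c.G y) = y := by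
  simpa using c.P_G y 0

/-- The surface measure near the centre of a chart is at most a multiple of the Lebesgue measure
of the base, because the graph map is Lipschitz. -/
theorem lintegral_frontier_inter_ball_le {F : EuclideanSpace ℝ (Fin d) → ℝ≥0∞}
    (hF : Measurable F) :
    ∫⁻ x, F x ∂surfaceMeasure (frontier U ∩ Metric.ball x₀ c.r) ≤
      (c.K : ℝ≥0∞) ^ (d - 1) * ∫⁻ y in Metric.ball (c.P x₀) c.r, F (c.G y) := by
  have hG : Measurable c.G := c.lipschitz_G.continuous.measurable
  have hle : surfaceMeasure (frontier U ∩ Metric.ball x₀ c.r) ≤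
      (c.K : ℝ≥0∞) ^ (d - 1) •
        (volume.restrict (Metric.ball (c.P x₀) c.r)).map c.G := by
    refine Measure.le_iff.2 fun A hA => ?_
    rw [surfaceMeasure, Measure.restrict_apply hA, Measure.smul_apply, Measure.map_apply hG hA,
      Measure.restrict_apply (hG hA), smul_eq_mul,
      ← EuclideanSpace.euclideanHausdorffMeasure_eq_volume]
    refine le_trans (measure_mono ?_)
      (c.lipschitz_G.euclideanHausdorffMeasure_image_le (d - 1) _)
    rintro x ⟨hxA, hx⟩
    obtain ⟨y, hy, rfl⟩ := c.frontier_subset hx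
    exact ⟨y, ⟨hxA, hy⟩, rfl⟩
  calc _ ≤ _ := lintegral_mono' hle le_rfl
    _ = _ := by rw [lintegral_smul_measure, lintegral_map hF hG, smul_eq_mul]

/-- The Lebesgue measure of the base is at most the surface measure of the graph, because the
projection to the base is nonexpansive. -/
theorem lintegral_ball_le {F : EuclideanSpace ℝ (Fin d) → ℝ≥0∞} (hF : Measurable F) :
    ∫⁻ y in Metric.ball (c.P x₀) c.r, F (c.G y) ≤ ∫⁻ x, F x ∂surfaceMeasure (frontier U) := by
  have hG : Measurable c.G := c.lipschitz_G.continuous.measurable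
  have hle : (volume.restrict (Metric.ball (c.P x₀) c.r)).map c.G ≤
      surfaceMeasure (frontier U) := by
    refine Measure.le_iff.2 fun A hA => ?_
    rw [surfaceMeasure, Measure.restrict_apply hA, Measure.map_apply hG hA,
      Measure.restrict_apply (hG hA), ← EuclideanSpace.euclideanHausdorffMeasure_eq_volume]
    have h := c.lipschitz_P.euclideanHausdorffMeasure_image_le (d - 1) (A ∩ frontier U)
    rw [ENNReal.coe_one, one_pow, one_mul] at h
    refine le_trans (measure_mono ?_) h
    rintro y ⟨hyA, hy⟩
    exact ⟨c.G y, ⟨hyA, c.G_mem y hy⟩, c.P_G_zero y⟩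
  calc _ = _ := (lintegral_map hF hG).symm
    _ ≤ _ := lintegral_mono' hle le_rfl

theorem lintegral_tube_eq {F : EuclideanSpace ℝ (Fin d) → ℝ≥0∞} (hF : Measurable F) :
    ∫⁻ y in Metric.ball (c.P x₀) c.r, ∫⁻ s in Set.Ioo 0 c.r, F (c.G y + s • c.e) =
      ∫⁻ p in Metric.ball (c.P x₀) c.r ×ˢ Set.Ioo 0 c.r, F (c.G p.1 + p.2 • c.e)
        ∂(volume.prod volume) := by
  rw [← Measure.prod_restrict, lintegral_prod]
  exact (hF.comp c.measurePreserving.measurable).aemeasurable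

/-- Integrals over the tube above the graph, in chart coordinates, are at most integrals over
`U`. -/
theorem lintegral_tube_le (hU : MeasurableSet U) {F : EuclideanSpace ℝ (Fin d) → ℝ≥0∞}
    (hF : Measurable F) :
    ∫⁻ y in Metric.ball (c.P x₀) c.r, ∫⁻ s in Set.Ioo 0 c.r, F (c.G y + s • c.e) ≤
      ∫⁻ x in U, F x := by
  rw [c.lintegral_tube_eq hF, ← c.measurePreserving.setLIntegral_comp_preimage hU hF]
  exact lintegral_mono_set fun p hp => c.above_mem p.1 hp.1 p.2 hp.2

/-- The tube above the graph contains a ball. -/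
theorem exists_ball_le_lintegral_tube :
    ∃ z ∈ U, ∃ δ > 0, ∀ F : EuclideanSpace ℝ (Fin d) → ℝ≥0∞, Measurable F →
      ∫⁻ x in Metric.ball z δ, F x ≤
        ∫⁻ y in Metric.ball (c.P x₀) c.r, ∫⁻ s in Set.Ioo 0 c.r, F (c.G y + s • c.e) := by
  have hr := c.r_pos
  refine ⟨c.G (c.P x₀) + (c.r / 2) • c.e, c.above_mem _ (Metric.mem_ball_self hr) _
    ⟨by linarith, by linarith⟩, c.r / (2 * (1 + c.K)), by positivity, fun F hF => ?_⟩
  rw [c.lintegral_tube_eq hF, ← c.measurePreserving.setLIntegral_comp_preimage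
    Metric.isOpen_ball.measurableSet hF]
  refine lintegral_mono_set fun p hp => ?_
  obtain ⟨y, s⟩ := p
  set δ := c.r / (2 * (1 + c.K)) with hδ
  have hδr : (1 + c.K) * δ = c.r / 2 := by rw [hδ]; field_simp
  have hδ0 : 0 < δ := by positivity
  have hK := c.K.2
  have hp' : dist (c.G y + s • c.e) (c.G (c.P x₀) + (c.r / 2) • c.e) < δ := hp
  have h1 : dist y (c.P x₀) < δ := by
    have := c.lipschitz_P.dist_le_mul (c.G y + s • c.e) (c.G (c.P x₀) + (c.r / 2) • c.e)
    rw [c.P_G, c.P_G, NNReal.coe_one, one_mul] at this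
    exact this.trans_lt hp'
  have h2 : |s - c.r / 2| < c.r / 2 := by
    have h3 := c.lipschitz_G.dist_le_mul y (c.P x₀)
    have h4 : |s - c.r / 2| = ‖(c.G y + s • c.e - (c.G (c.P x₀) + (c.r / 2) • c.e)) -
        (c.G y - c.G (c.P x₀))‖ := by
      have : (c.G y + s • c.e - (c.G (c.P x₀) + (c.r / 2) • c.e)) - (c.G y - c.G (c.P x₀)) =
          (s - c.r / 2) • c.e := by rw [sub_smul]; abel
      rw [this, norm_smul, c.norm_e, mul_one, Real.norm_eq_abs]
    rw [dist_eq_norm] at hp' h3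
    rw [h4]
    have h5 := norm_sub_le (c.G y + s • c.e - (c.G (c.P x₀) + (c.r / 2) • c.e))
      (c.G y - c.G (c.P x₀))
    have h6 : (c.K : ℝ) * dist y (c.P x₀) ≤ c.K * δ := by gcongr
    linarith
  rw [abs_lt] at h2
  refine ⟨?_, by linarith, by linarith⟩
  have : δ ≤ c.r := by nlinarith [mul_nonneg hK hδ0.le]
  exact h1.trans_le this

/-- Bounds the values of `φ` on the graph by averaging the fundamental theorem of calculus over
the heights `s ∈ (0, r)`. -/
theorem lintegral_graph_le_tube {φ : EuclideanSpace ℝ (Fin d) → ℝ} (hφ : ContDiff ℝ 1 φ) :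
    ENNReal.ofReal c.r * ∫⁻ y in Metric.ball (c.P x₀) c.r, ‖φ (c.G y)‖ₑ ^ 2 ≤
      2 * (∫⁻ y in Metric.ball (c.P x₀) c.r, ∫⁻ s in Set.Ioo 0 c.r, ‖φ (c.G y + s • c.e)‖ₑ ^ 2) +
      ENNReal.ofReal c.r * (2 * (ENNReal.ofReal c.r *
        ∫⁻ y in Metric.ball (c.P x₀) c.r,
          ∫⁻ s in Set.Ioo 0 c.r, ‖gradient φ (c.G y + s • c.e)‖ₑ ^ 2)) := by
  have hmφ : Measurable fun x => ‖φ x‖ₑ ^ 2 := (hφ.continuous.measurable.enorm).pow_const 2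
  have hmΨ : Measurable fun p : EuclideanSpace ℝ (Fin (d - 1)) × ℝ =>
      ‖φ (c.G p.1 + p.2 • c.e)‖ₑ ^ 2 := hmφ.comp c.measurePreserving.measurable
  have hm1 : Measurable fun y => ∫⁻ s in Set.Ioo 0 c.r, ‖φ (c.G y + s • c.e)‖ₑ ^ 2 :=
    hmΨ.lintegral_prod_right'
  rw [← lintegral_const_mul' _ _ (by simp), ← lintegral_const_mul' _ _ (by simp),
    ← lintegral_const_mul' _ _ (by simp), ← lintegral_const_mul' _ _ (by simp),
    ← lintegral_const_mul' _ _ (by simp), ← lintegral_add_left (hm1.const_mul 2)]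
  refine lintegral_mono fun y => ?_
  calc ENNReal.ofReal c.r * ‖φ (c.G y)‖ₑ ^ 2
      = ∫⁻ s in Set.Ioo 0 c.r, ‖φ (c.G y)‖ₑ ^ 2 := by simp [mul_comm]
    _ ≤ ∫⁻ s in Set.Ioo 0 c.r, (2 * ‖φ (c.G y + s • c.e)‖ₑ ^ 2 + 2 * (ENNReal.ofReal c.r *
          ∫⁻ s in Set.Ioo 0 c.r, ‖gradient φ (c.G y + s • c.e)‖ₑ ^ 2)) := by
        refine setLIntegral_mono' measurableSet_Ioo fun s hs => ?_
        refine (enorm_sq_le_add_lintegral_gradient hφ (c.G y) c.e hs.1.le).trans ?_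
        rw [← enorm_norm c.e, c.norm_e, enorm_one, one_pow, one_mul]
        refine add_le_add le_rfl (mul_le_mul_right (mul_le_mul' ?_ ?_) _)
        · exact ENNReal.ofReal_le_ofReal hs.2.le
        · exact lintegral_mono_set fun t ht => ⟨ht.1, ht.2.trans_lt hs.2⟩
    _ = _ := by
        have hms : Measurable fun s : ℝ => 2 * ‖φ (c.G y + s • c.e)‖ₑ ^ 2 :=
          (hmΨ.comp measurable_prodMk_left).const_mul 2
        rw [lintegral_add_left hms, lintegral_const_mul' _ _ (by simp), setLIntegral_const]
        simp only [Real.volume_Ioo, sub_zero]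
        rw [mul_comm (ENNReal.ofReal c.r) (2 * _)]

/-- Bounds `φ` on the tube by its values on the graph, integrating along the chart direction. -/
theorem lintegral_tube_le_graph {φ : EuclideanSpace ℝ (Fin d) → ℝ} (hφ : ContDiff ℝ 1 φ) :
    ∫⁻ y in Metric.ball (c.P x₀) c.r, ∫⁻ s in Set.Ioo 0 c.r, ‖φ (c.G y + s • c.e)‖ₑ ^ 2 ≤
      ENNReal.ofReal c.r * (2 * ∫⁻ y in Metric.ball (c.P x₀) c.r, ‖φ (c.G y)‖ₑ ^ 2) +
      ENNReal.ofReal c.r * (2 * (ENNReal.ofReal c.r *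
        ∫⁻ y in Metric.ball (c.P x₀) c.r,
          ∫⁻ s in Set.Ioo 0 c.r, ‖gradient φ (c.G y + s • c.e)‖ₑ ^ 2)) := by
  have hm1 : Measurable fun y => ‖φ (c.G y)‖ₑ ^ 2 :=
    ((hφ.continuous.comp c.lipschitz_G.continuous).measurable.enorm).pow_const 2
  have hm2 : Measurable fun y => ENNReal.ofReal c.r * (2 * ‖φ (c.G y)‖ₑ ^ 2) :=
    (hm1.const_mul 2).const_mul _
  rw [← lintegral_const_mul' _ _ (by simp), ← lintegral_const_mul' _ _ (by simp),
    ← lintegral_const_mul' _ _ (by simp), ← lintegral_const_mul' _ _ (by simp),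
    ← lintegral_const_mul' _ _ (by simp), ← lintegral_add_left hm2]
  refine lintegral_mono fun y => ?_
  calc ∫⁻ s in Set.Ioo 0 c.r, ‖φ (c.G y + s • c.e)‖ₑ ^ 2
      ≤ ∫⁻ s in Set.Ioo 0 c.r, (2 * ‖φ (c.G y)‖ₑ ^ 2 + 2 * (ENNReal.ofReal c.r *
          ∫⁻ s in Set.Ioo 0 c.r, ‖gradient φ (c.G y + s • c.e)‖ₑ ^ 2)) := by
        refine setLIntegral_mono' measurableSet_Ioo fun s hs => ?_
        refine (enorm_sq_add_le_add_lintegral_gradient hφ (c.G y) c.e hs.1.le).trans ?_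
        rw [← enorm_norm c.e, c.norm_e, enorm_one, one_pow, one_mul]
        refine add_le_add le_rfl (mul_le_mul_right (mul_le_mul' ?_ ?_) _)
        · exact ENNReal.ofReal_le_ofReal hs.2.le
        · exact lintegral_mono_set fun t ht => ⟨ht.1, ht.2.trans_lt hs.2⟩
    _ = _ := by
        rw [setLIntegral_const]
        simp only [Real.volume_Ioo, sub_zero]
        rw [mul_comm, mul_add]

end BoundaryChart

/-! ### The trace inequality -/

/-- The trace inequality on the boundary of a bounded Lipschitz domain. The surface integral being
taken in `[0, ∞]`, its finiteness is part of the statement. -/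
theorem HasLipschitzBoundary.exists_lintegral_frontier_le {d : ℕ}
    {U : Set (EuclideanSpace ℝ (Fin d))} (hU : IsOpen U) (hb : Bornology.IsBounded U)
    (hL : HasLipschitzBoundary U) :
    ∃ C : NNReal, ∀ φ : EuclideanSpace ℝ (Fin d) → ℝ, ContDiff ℝ 1 φ →
      ∫⁻ x, ‖φ x‖ₑ ^ 2 ∂surfaceMeasure (frontier U) ≤
        C * ((∫⁻ x in U, ‖φ x‖ₑ ^ 2) + ∫⁻ x in U, ‖gradient φ x‖ₑ ^ 2) := by
  have hcomp : IsCompact (frontier U) :=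
    Metric.isCompact_of_isClosed_isBounded isClosed_frontier
      (hb.closure.subset frontier_subset_closure)
  refine hcomp.induction_on (p := fun S => ∃ C : NNReal,
    ∀ φ : EuclideanSpace ℝ (Fin d) → ℝ, ContDiff ℝ 1 φ →
      ∫⁻ x, ‖φ x‖ₑ ^ 2 ∂surfaceMeasure S ≤
        C * ((∫⁻ x in U, ‖φ x‖ₑ ^ 2) + ∫⁻ x in U, ‖gradient φ x‖ₑ ^ 2)) ?_ ?_ ?_ ?_
  · exact ⟨0, fun φ _ => by simp [surfaceMeasure]⟩
  · rintro S S' hS ⟨C, hC⟩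
    exact ⟨C, fun φ hφ => (lintegral_mono_set hS).trans (hC φ hφ)⟩
  · rintro S S' ⟨C, hC⟩ ⟨C', hC'⟩
    refine ⟨C + C', fun φ hφ => (lintegral_union_le _ _ _).trans ?_⟩
    rw [ENNReal.coe_add, add_mul]
    exact add_le_add (hC φ hφ) (hC' φ hφ)
  · intro x₀ hx₀
    obtain ⟨c⟩ := hL.exists_chart hU hx₀
    have hr := c.r_pos
    refine ⟨frontier U ∩ Metric.ball x₀ c.r, inter_mem_nhdsWithin _ (Metric.ball_mem_nhds _ hr),
      c.K ^ (d - 1) * (2 * (c.r.toNNReal⁻¹ + c.r.toNNReal)), fun φ hφ => ?_⟩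
    have hmφ : Measurable fun x => ‖φ x‖ₑ ^ 2 := (hφ.continuous.measurable.enorm).pow_const 2
    have hmg : Measurable fun x => ‖gradient φ x‖ₑ ^ 2 :=
      hφ.continuous_gradient.measurable.enorm.pow_const 2
    have h1 := c.lintegral_frontier_inter_ball_le hmφ
    have h2 := c.lintegral_graph_le_tube hφ
    have h3 := c.lintegral_tube_le hU.measurableSet hmφ
    have h4 := c.lintegral_tube_le hU.measurableSet hmg
    refine h1.trans ?_
    rw [ENNReal.coe_mul, ENNReal.coe_pow, mul_assoc]
    gcongr
    have hr0 : ENNReal.ofReal c.r ≠ 0 := by simpa using hr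
    have hinv : ((c.r.toNNReal⁻¹ : NNReal) : ℝ≥0∞) = (ENNReal.ofReal c.r)⁻¹ :=
      ENNReal.coe_inv (by simpa using hr)
    rw [← ENNReal.mul_le_mul_iff_right hr0 ENNReal.ofReal_ne_top]
    refine h2.trans ?_
    push_cast
    rw [hinv]
    change _ ≤ ENNReal.ofReal c.r * (2 * ((ENNReal.ofReal c.r)⁻¹ + ENNReal.ofReal c.r) * _)
    set a := ∫⁻ x in U, ‖φ x‖ₑ ^ 2
    set b := ∫⁻ x in U, ‖gradient φ x‖ₑ ^ 2
    set ρ := ENNReal.ofReal c.r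
    have hρ : ρ * ρ⁻¹ = 1 := ENNReal.mul_inv_cancel hr0 ENNReal.ofReal_ne_top
    calc _ ≤ 2 * a + ρ * (2 * (ρ * b)) := by gcongr
      _ ≤ 2 * a + ρ * (2 * (ρ * b)) + (2 * b + ρ * (2 * (ρ * a))) := le_self_add
      _ = (ρ * ρ⁻¹) * (2 * (a + b)) + ρ * (2 * ρ * (a + b)) := by rw [hρ]; ring
      _ = _ := by ring

/-- A set of finite `(d-1)`-dimensional measure is Lebesgue null. -/
theorem volume_eq_zero_of_surfaceMeasure_ne_top {d : ℕ} (hd : 1 ≤ d)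
    {S : Set (EuclideanSpace ℝ (Fin d))} (hS : surfaceMeasure S Set.univ ≠ ⊤) :
    volume S = 0 := by
  have h := Measure.euclideanHausdorffMeasure_zero_or_top (show d - 1 < d by omega) S
  rw [EuclideanSpace.euclideanHausdorffMeasure_eq_volume] at h
  refine h.resolve_right fun h => hS ?_
  simpa [surfaceMeasure] using h

/-! ### A Poincaré inequality with a boundary term -/

/-- The `L²` norm on `A` of every `C¹` function is controlled by its Dirichlet energy in `Ω` and
its `L²(ν)` norm. -/
def EnergyControlled {d : ℕ} (Ω : Set (EuclideanSpace ℝ (Fin d)))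
    (ν : Measure (EuclideanSpace ℝ (Fin d))) (A : Set (EuclideanSpace ℝ (Fin d))) : Prop :=
  ∃ C : NNReal, ∀ φ : EuclideanSpace ℝ (Fin d) → ℝ, ContDiff ℝ 1 φ →
    ∫⁻ x in A, ‖φ x‖ₑ ^ 2 ≤ C * ((∫⁻ x in Ω, ‖gradient φ x‖ₑ ^ 2) + ∫⁻ x, ‖φ x‖ₑ ^ 2 ∂ν)

namespace EnergyControlled

variable {d : ℕ} {Ω A B : Set (EuclideanSpace ℝ (Fin d))}
  {ν : Measure (EuclideanSpace ℝ (Fin d))}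

theorem mono (h : EnergyControlled Ω ν B) (hAB : A ⊆ B) : EnergyControlled Ω ν A := by
  obtain ⟨C, hC⟩ := h
  exact ⟨C, fun φ hφ => (lintegral_mono_set hAB).trans (hC φ hφ)⟩

theorem union (hA : EnergyControlled Ω ν A) (hB : EnergyControlled Ω ν B) :
    EnergyControlled Ω ν (A ∪ B) := by
  obtain ⟨C, hC⟩ := hA
  obtain ⟨C', hC'⟩ := hB
  refine ⟨C + C', fun φ hφ => (lintegral_union_le _ _ _).trans ?_⟩
  rw [ENNReal.coe_add, add_mul]
  exact add_le_add (hC φ hφ) (hC' φ hφ)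

theorem of_translate (hΩ : MeasurableSet Ω) (hB : MeasurableSet B)
    (h : EnergyControlled Ω ν B) {v : EuclideanSpace ℝ (Fin d)}
    (hAΩ : ∀ x ∈ A, ∀ t ∈ Set.Icc (0 : ℝ) 1, x + t • v ∈ Ω) (hAB : ∀ x ∈ A, x + v ∈ B) :
    EnergyControlled Ω ν A := by
  obtain ⟨C, hC⟩ := h
  refine ⟨2 * C + 2 * ‖v‖₊ ^ 2, fun φ hφ => ?_⟩
  refine (lintegral_enorm_sq_le_translate hΩ hB hAΩ hAB hφ).trans ?_
  have h1 := hC φ hφ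
  push_cast
  rw [add_mul, mul_assoc, mul_assoc]
  refine add_le_add (mul_le_mul_right h1 _)
    (mul_le_mul_right (mul_le_mul_right le_self_add _) _)

/-- In a connected open set, energy control of one ball spreads to a ball around every point,
by translating small balls. -/
theorem exists_ball (hΩ : IsOpen Ω) (hconn : IsPreconnected Ω) {z : EuclideanSpace ℝ (Fin d)}
    (hz : z ∈ Ω) {δ : ℝ} (hδ : 0 < δ) (h : EnergyControlled Ω ν (Metric.ball z δ)) :
    ∀ x ∈ Ω, ∃ r > 0, EnergyControlled Ω ν (Metric.ball x r) := by
  set S : Set (EuclideanSpace ℝ (Fin d)) :=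
    {x | ∃ r > 0, EnergyControlled Ω ν (Metric.ball x r)} with hS
  have hSo : IsOpen S := by
    refine Metric.isOpen_iff.2 ?_
    rintro x ⟨r, hr, hx⟩
    refine ⟨r / 2, by positivity, fun y hy => ⟨r / 2, by positivity, hx.mono ?_⟩⟩
    refine Metric.ball_subset_ball' ?_
    have := Metric.mem_ball.1 hy
    linarith
  suffices Ω ⊆ S from fun x hx => this hx
  refine hconn.subset_of_closure_inter_subset hSo ⟨z, hz, δ, hδ, h⟩ ?_
  rintro x ⟨hxS, hxΩ⟩
  obtain ⟨R, hR, hRΩ⟩ := Metric.isOpen_iff.1 hΩ x hxΩ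
  obtain ⟨y, ⟨r, hr, hyr⟩, hxy⟩ := Metric.mem_closure_iff.1 hxS (R / 2) (by positivity)
  refine ⟨min r (R / 2), by positivity, ?_⟩
  refine hyr.of_translate hΩ.measurableSet Metric.isOpen_ball.measurableSet (v := y - x) ?_ ?_
  · intro w hw t ht
    refine hRΩ ?_
    have h1 : dist w x < R / 2 := (Metric.mem_ball.1 hw).trans_le (min_le_right _ _)
    have h2 : ‖t • (y - x)‖ ≤ R / 2 := by
      rw [norm_smul, Real.norm_eq_abs, abs_of_nonneg ht.1, ← dist_eq_norm, dist_comm]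
      nlinarith [ht.2, dist_nonneg (x := x) (y := y)]
    rw [Metric.mem_ball, dist_eq_norm] at *
    have h3 : w + t • (y - x) - x = (w - x) + t • (y - x) := by abel
    rw [h3]
    linarith [norm_add_le (w - x) (t • (y - x))]
  · intro w hw
    have h1 : dist w x < r := (Metric.mem_ball.1 hw).trans_le (min_le_left _ _)
    rw [Metric.mem_ball, dist_eq_norm] at *
    have h3 : w + (y - x) - y = w - x := by abel
    rwa [h3]

/-- Near a boundary point, energy control follows from control inside, by translating into the
domain along the chart direction. -/
theorem exists_ball_inter (hΩ : IsOpen Ω)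
    (hin : ∀ x ∈ Ω, ∃ r > 0, EnergyControlled Ω ν (Metric.ball x r))
    {x₀ : EuclideanSpace ℝ (Fin d)} (c : BoundaryChart Ω x₀) :
    ∃ ρ > 0, EnergyControlled Ω ν (Ω ∩ Metric.ball x₀ ρ) := by
  have hr := c.r_pos
  have hx₁ : x₀ + (c.r / 2) • c.e ∈ Ω := by
    have := c.above_mem (c.P x₀) (Metric.mem_ball_self hr) (c.r / 2) ⟨by linarith, by linarith⟩
    rwa [c.G_center] at this
  obtain ⟨δ, hδ, hB⟩ := hin _ hx₁
  refine ⟨min δ (c.r / 2), by positivity, ?_⟩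
  refine hB.of_translate hΩ.measurableSet Metric.isOpen_ball.measurableSet
    (v := (c.r / 2) • c.e) ?_ ?_
  · rintro x ⟨hxΩ, hx⟩ t ht
    have h1 : dist x x₀ < c.r / 2 := (Metric.mem_ball.1 hx).trans_le (min_le_right _ _)
    rw [smul_smul]
    refine c.translate_mem x hxΩ (by rw [Metric.mem_ball]; linarith) _
      (mul_nonneg ht.1 (by linarith)) ?_
    have h2 : ‖(t * (c.r / 2)) • c.e‖ ≤ c.r / 2 := by
      rw [norm_smul, c.norm_e, mul_one, Real.norm_eq_abs,
        abs_of_nonneg (mul_nonneg ht.1 (by linarith))]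
      nlinarith [ht.2]
    rw [Metric.mem_ball, dist_eq_norm] at *
    have h3 : x + (t * (c.r / 2)) • c.e - x₀ = (x - x₀) + (t * (c.r / 2)) • c.e := by abel
    rw [h3]
    linarith [norm_add_le (x - x₀) ((t * (c.r / 2)) • c.e)]
  · rintro x ⟨_, hx⟩
    have h1 : dist x x₀ < δ := (Metric.mem_ball.1 hx).trans_le (min_le_left _ _)
    rwa [Metric.mem_ball, dist_add_right]

end EnergyControlled

/-- The boundary term on `Γ = ∂Ω₁` controls `φ` in a ball touching `Γ` through a chart, and the
control spreads over the connected set `Ω` and up to its boundary. -/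
theorem energyControlled_surfaceMeasure_frontier {d : ℕ} {Ω Ω₁ : Set (EuclideanSpace ℝ (Fin d))}
    (hΩ_open : IsOpen Ω) (hΩ_conn : IsPreconnected Ω) (hΩ_bdd : Bornology.IsBounded Ω)
    (hΩ_lip : HasLipschitzBoundary Ω) (hΩ₁_open : IsOpen Ω₁) (hΩ₁_sub : Ω₁ ⊆ Ω)
    (hΩ₁_lip : HasLipschitzBoundary Ω₁) (hΓ : (frontier Ω₁).Nonempty) :
    EnergyControlled Ω (surfaceMeasure (frontier Ω₁)) Ω := by
  obtain ⟨x₀, hx₀⟩ := hΓ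
  obtain ⟨c⟩ := hΩ₁_lip.exists_chart hΩ₁_open hx₀
  obtain ⟨z, hz, δ, hδ, hball⟩ := c.exists_ball_le_lintegral_tube
  have hr := c.r_pos
  have hzB : EnergyControlled Ω (surfaceMeasure (frontier Ω₁)) (Metric.ball z δ) := by
    refine ⟨2 * c.r.toNNReal + 2 * c.r.toNNReal ^ 2, fun φ hφ => ?_⟩
    have hmφ : Measurable fun x => ‖φ x‖ₑ ^ 2 := (hφ.continuous.measurable.enorm).pow_const 2
    have hmg : Measurable fun x => ‖gradient φ x‖ₑ ^ 2 :=
      hφ.continuous_gradient.measurable.enorm.pow_const 2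
    refine (hball _ hmφ).trans ((c.lintegral_tube_le_graph hφ).trans ?_)
    have h1 := c.lintegral_ball_le hmφ
    have h2 := (c.lintegral_tube_le hΩ₁_open.measurableSet hmg).trans
      (lintegral_mono_set hΩ₁_sub)
    push_cast
    change _ ≤ (2 * ENNReal.ofReal c.r + 2 * ENNReal.ofReal c.r ^ 2) * _
    set a := ∫⁻ x in Ω, ‖gradient φ x‖ₑ ^ 2
    set b := ∫⁻ x, ‖φ x‖ₑ ^ 2 ∂surfaceMeasure (frontier Ω₁)
    set ρ := ENNReal.ofReal c.r
    calc _ ≤ ρ * (2 * b) + ρ * (2 * (ρ * a)) := by gcongr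
      _ ≤ ρ * (2 * b) + ρ * (2 * (ρ * a)) + (ρ * (2 * a) + ρ * (2 * (ρ * b))) := le_self_add
      _ = _ := by ring
  have hin := hzB.exists_ball hΩ_open hΩ_conn (hΩ₁_sub hz) hδ
  have hcomp : IsCompact (closure Ω) :=
    Metric.isCompact_of_isClosed_isBounded isClosed_closure hΩ_bdd.closure
  have key : EnergyControlled Ω (surfaceMeasure (frontier Ω₁)) (Ω ∩ closure Ω) := by
    refine hcomp.induction_on
      (p := fun S => EnergyControlled Ω (surfaceMeasure (frontier Ω₁)) (Ω ∩ S)) ?_ ?_ ?_ ?_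
    · exact ⟨0, fun φ _ => by simp⟩
    · exact fun S S' hS h => h.mono (Set.inter_subset_inter_right _ hS)
    · intro S S' h h'
      rw [Set.inter_union_distrib_left]
      exact h.union h'
    · intro x hx
      by_cases hxΩ : x ∈ Ω
      · obtain ⟨r, hr, h⟩ := hin x hxΩ
        exact ⟨_, mem_nhdsWithin_of_mem_nhds (Metric.ball_mem_nhds x hr),
          h.mono Set.inter_subset_right⟩
      · obtain ⟨c'⟩ := hΩ_lip.exists_chart hΩ_open (x₀ := x)
          (by rw [hΩ_open.frontier_eq]; exact ⟨hx, hxΩ⟩)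
        obtain ⟨ρ, hρ, h⟩ := EnergyControlled.exists_ball_inter hΩ_open hin c'
        exact ⟨_, mem_nhdsWithin_of_mem_nhds (Metric.ball_mem_nhds x hρ), h⟩
  exact key.mono fun x hx => ⟨hx, subset_closure hx⟩

/-! ### Smooth functions in `L²` spaces -/

section SmoothFunctions

variable (E : Type*) [NormedAddCommGroup E] [InnerProductSpace ℝ E]

/-- The real vector space of smooth functions on the whole space. -/
def smoothFunctions : Submodule ℝ (E → ℝ) where
  carrier := {φ | ContDiff ℝ ∞ φ}
  add_mem' {φ ψ} (h : ContDiff ℝ ∞ φ) (h' : ContDiff ℝ ∞ ψ) := h.add h'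
  zero_mem' := (contDiff_const : ContDiff ℝ ∞ fun _ : E => (0 : ℝ))
  smul_mem' c φ (h : ContDiff ℝ ∞ φ) := h.const_smul c

variable {E}

theorem gradient_add' [CompleteSpace E] {φ ψ : E → ℝ} (hφ : ContDiff ℝ ∞ φ) (hψ : ContDiff ℝ ∞ ψ) :
    gradient (φ + ψ) = gradient φ + gradient ψ := by
  funext x
  simp only [gradient, Pi.add_apply]
  rw [fderiv_add (hφ.differentiable (by simp) x) (hψ.differentiable (by simp) x), map_add]

theorem gradient_const_smul' [CompleteSpace E] {φ : E → ℝ} (hφ : ContDiff ℝ ∞ φ) (c : ℝ) :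
    gradient (c • φ) = c • gradient φ := by
  funext x
  simp only [gradient, Pi.smul_apply]
  rw [fderiv_const_smul (hφ.differentiable (by simp) x)]
  simp

variable [MeasurableSpace E]

/-- The class in `L²(ν)` of a smooth function. -/
noncomputable def toL2 (ν : Measure E) (h : ∀ φ : E → ℝ, ContDiff ℝ ∞ φ → MemLp φ 2 ν) :
    smoothFunctions E →ₗ[ℝ] Lp ℝ 2 ν where
  toFun φ := (h φ φ.2).toLp φ
  map_add' _ _ := rfl
  map_smul' _ _ := rfl

theorem coeFn_toL2 (ν : Measure E) (h : ∀ φ : E → ℝ, ContDiff ℝ ∞ φ → MemLp φ 2 ν)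
    (φ : smoothFunctions E) : toL2 ν h φ =ᵐ[ν] φ := (h φ φ.2).coeFn_toLp

variable [CompleteSpace E]

/-- The class in `L²(ν)` of the gradient of a smooth function. -/
noncomputable def gradL2 (ν : Measure E)
    (h : ∀ φ : E → ℝ, ContDiff ℝ ∞ φ → MemLp (gradient φ) 2 ν) :
    smoothFunctions E →ₗ[ℝ] Lp E 2 ν where
  toFun φ := (h φ φ.2).toLp (gradient (φ : E → ℝ))
  map_add' φ ψ :=
    (MemLp.toLp_congr _ ((h φ φ.2).add (h ψ ψ.2))
      (Eventually.of_forall (congrFun (gradient_add' φ.2 ψ.2)))).trans (MemLp.toLp_add _ _)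
  map_smul' c φ :=
    (MemLp.toLp_congr _ ((h φ φ.2).const_smul c)
      (Eventually.of_forall (congrFun (gradient_const_smul' φ.2 c)))).trans
      (MemLp.toLp_const_smul _ _)

theorem coeFn_gradL2 (ν : Measure E)
    (h : ∀ φ : E → ℝ, ContDiff ℝ ∞ φ → MemLp (gradient φ) 2 ν)
    (φ : smoothFunctions E) : gradL2 ν h φ =ᵐ[ν] gradient (φ : E → ℝ) :=
  (h φ φ.2).coeFn_toLp

end SmoothFunctions

theorem ofReal_norm_sq_Lp {α F : Type*} [MeasurableSpace α] [NormedAddCommGroup F]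
    {ν : Measure α} (f : Lp F 2 ν) : ENNReal.ofReal (‖f‖ ^ 2) = ∫⁻ x, ‖f x‖ₑ ^ 2 ∂ν := by
  rw [ENNReal.ofReal_pow (norm_nonneg f), ofReal_norm, Lp.enorm_def,
    eLpNorm_eq_lintegral_rpow_enorm_toReal (by simp) (by simp)]
  rw [← ENNReal.rpow_two, ← ENNReal.rpow_mul]
  simp

theorem memLp_two_of_continuous {E F : Type*} [TopologicalSpace E] [MeasurableSpace E]
    [OpensMeasurableSpace E] [NormedAddCommGroup F] [SecondCountableTopology F] {ν : Measure E}
    [IsFiniteMeasure ν] {K : Set E}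
    (hK : IsCompact K) (hν : ∀ᵐ x ∂ν, x ∈ K) {f : E → F} (hf : Continuous f) : MemLp f 2 ν := by
  borelize F
  obtain ⟨C, hC⟩ := hK.exists_bound_of_continuousOn hf.continuousOn
  exact MemLp.of_bound hf.measurable.aestronglyMeasurable C (hν.mono fun x hx => hC x hx)

/-! ### Sequences under dominated linear maps -/

section Dominated

variable {M A B : Type*} [AddCommGroup M] [Module ℝ M] [NormedAddCommGroup A] [NormedSpace ℝ A]
  [NormedAddCommGroup B] [NormedSpace ℝ B] {S : M →ₗ[ℝ] A} {T : M →ₗ[ℝ] B} {C : ℝ}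

/-- If `S` dominates `T`, the limit of `T (φ n)` depends only on the limit of `S (φ n)`. -/
theorem tendsto_of_dominated (hST : ∀ m, ‖T m‖ ≤ C * ‖S m‖) {φ ψ : ℕ → M} {a : A} {b : B}
    (hφ : Tendsto (fun n => S (φ n)) atTop (𝓝 a)) (hψ : Tendsto (fun n => S (ψ n)) atTop (𝓝 a))
    (hb : Tendsto (fun n => T (ψ n)) atTop (𝓝 b)) :
    Tendsto (fun n => T (φ n)) atTop (𝓝 b) := by
  have h1 : Tendsto (fun n => S (φ n - ψ n)) atTop (𝓝 0) := by
    simpa using hφ.sub hψ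
  have h2 : Tendsto (fun n => T (φ n - ψ n)) atTop (𝓝 0) :=
    squeeze_zero_norm (fun n => hST _) (by simpa using h1.norm.const_mul C)
  simpa using h2.add hb

theorem exists_tendsto_of_dominated [CompleteSpace B] (hST : ∀ m, ‖T m‖ ≤ C * ‖S m‖)
    {φ : ℕ → M} {a : A} (hφ : Tendsto (fun n => S (φ n)) atTop (𝓝 a)) :
    ∃ b, Tendsto (fun n => T (φ n)) atTop (𝓝 b) := by
  refine cauchySeq_tendsto_of_complete (cauchySeq_iff_tendsto_dist_atTop_0.2 ?_)
  have h1 := (cauchySeq_iff_tendsto_dist_atTop_0.1 hφ.cauchySeq).const_mul C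
  rw [mul_zero] at h1
  refine squeeze_zero (fun _ => dist_nonneg) (fun p => ?_) h1
  rw [dist_eq_norm, dist_eq_norm, ← map_sub, ← map_sub]
  exact hST _

end Dominated

/-! ### Weighted bilinear forms on `L²` and the Lax–Milgram theorem -/

section Forms

variable {α F : Type*} [MeasurableSpace α] [NormedAddCommGroup F] [InnerProductSpace ℝ F]
  {ν : Measure α}

/-- The bilinear form `(f, g) ↦ ∫ m ⟪f, g⟫` on `L²` with a bounded weight `m`. -/
noncomputable def weightedForm (m : Lp ℝ ∞ ν) : Lp F 2 ν →L[ℝ] Lp F 2 ν →L[ℝ] ℝ :=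
  (innerSL ℝ).comp ((ContinuousLinearMap.lsmul ℝ ℝ).holderL ν ∞ 2 2 m)

theorem coeFn_weight (m : Lp ℝ ∞ ν) (f : Lp F 2 ν) :
    (ContinuousLinearMap.lsmul ℝ ℝ (E := F)).holderL ν ∞ 2 2 m f =ᵐ[ν] fun x => m x • f x :=
  ContinuousLinearMap.coeFn_holder _ _ _

theorem integrable_weightedForm (m : Lp ℝ ∞ ν) (f g : Lp F 2 ν) :
    Integrable (fun x => m x * inner ℝ (f x) (g x)) ν := by
  refine (L2.integrable_inner (𝕜 := ℝ)
    ((ContinuousLinearMap.lsmul ℝ ℝ (E := F)).holderL ν ∞ 2 2 m f) g).congr ?_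
  filter_upwards [coeFn_weight m f] with x hx
  rw [hx, real_inner_smul_left]

theorem weightedForm_apply (m : Lp ℝ ∞ ν) (f g : Lp F 2 ν) :
    weightedForm m f g = ∫ x, m x * inner ℝ (f x) (g x) ∂ν := by
  change inner ℝ ((ContinuousLinearMap.lsmul ℝ ℝ (E := F)).holderL ν ∞ 2 2 m f) g = _
  rw [L2.inner_def]
  refine integral_congr_ae ?_
  filter_upwards [coeFn_weight m f] with x hx
  rw [hx, real_inner_smul_left]

theorem weightedForm_comm (m : Lp ℝ ∞ ν) (f g : Lp F 2 ν) :
    weightedForm m f g = weightedForm m g f := by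
  simp only [weightedForm_apply, real_inner_comm]

theorem mul_norm_sq_le_weightedForm {m : Lp ℝ ∞ ν} {c : ℝ} (hm : ∀ᵐ x ∂ν, c ≤ m x)
    (f : Lp F 2 ν) : c * ‖f‖ ^ 2 ≤ weightedForm m f f := by
  rw [weightedForm_apply, ← real_inner_self_eq_norm_sq, L2.inner_def, ← integral_const_mul]
  refine integral_mono_ae ((L2.integrable_inner f f).const_mul c)
    (integrable_weightedForm m f f) ?_
  filter_upwards [hm] with x hx
  exact mul_le_mul_of_nonneg_right hx real_inner_self_nonneg

end Forms

/-- The Lax–Milgram theorem for a bilinear form that is coercive on the closure of the range of a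
linear map; coercivity need only be checked on the range itself. -/
theorem exists_mem_closure_range_forall_eq {M X : Type*} [AddCommGroup M] [Module ℝ M]
    [NormedAddCommGroup X] [InnerProductSpace ℝ X] [CompleteSpace X] (J : M →ₗ[ℝ] X)
    (B : X →L[ℝ] X →L[ℝ] ℝ) {c : ℝ} (hc : 0 < c) (hB : ∀ m, c * ‖J m‖ ^ 2 ≤ B (J m) (J m))
    (l : X →L[ℝ] ℝ) :
    ∃ u ∈ closure (Set.range J), ∀ w ∈ closure (Set.range J), B u w = l w := by
  let V : Submodule ℝ X := J.range.topologicalClosure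
  have hV : (V : Set X) = closure (Set.range J) := by
    rw [Submodule.topologicalClosure_coe, LinearMap.coe_range]
  have : CompleteSpace V := J.range.isClosed_topologicalClosure.completeSpace_coe
  let b : V →L[ℝ] V →L[ℝ] ℝ := B.bilinearComp V.subtypeL V.subtypeL
  have hb : IsCoercive b := by
    refine ⟨c, hc, fun v => ?_⟩
    have hclosed : IsClosed {x : X | c * ‖x‖ ^ 2 ≤ B x x} :=
      isClosed_le (by fun_prop) (by fun_prop)
    have hsub : closure (Set.range J) ⊆ {x : X | c * ‖x‖ ^ 2 ≤ B x x} :=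
      closure_minimal (by rintro _ ⟨m, rfl⟩; exact hB m) hclosed
    have h := hsub (hV.subset v.2)
    have h' : c * ‖(v : X)‖ ^ 2 ≤ B v v := h
    calc c * ‖v‖ * ‖v‖ = c * ‖(v : X)‖ ^ 2 := by rw [Submodule.coe_norm]; ring
      _ ≤ _ := h'
  let f : V := (InnerProductSpace.toDual ℝ V).symm (l.comp V.subtypeL)
  let u : V := hb.continuousLinearEquivOfBilin.symm f
  refine ⟨u, hV.subset u.2, fun w hw => ?_⟩
  have hw' : w ∈ V := by rw [← SetLike.mem_coe, hV]; exact hw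
  have h := hb.continuousLinearEquivOfBilin_apply u ⟨w, hw'⟩
  rw [ContinuousLinearEquiv.apply_symm_apply, InnerProductSpace.toDual_symm_apply] at h
  exact h.symm

/-! ### Integration by parts against a test function -/

section WeakGradient

theorem integral_smul_gradient {d : ℕ} {φ ψ : EuclideanSpace ℝ (Fin d) → ℝ}
    (hφ : ContDiff ℝ ∞ φ) (hψ : ContDiff ℝ ∞ ψ) (hc : HasCompactSupport ψ) :
    ∫ x, φ x • gradient ψ x = - ∫ x, ψ x • gradient φ x := by
  have hφ1 : ContDiff ℝ 1 φ := hφ.of_le (by simp)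
  have hψ1 : ContDiff ℝ 1 ψ := hψ.of_le (by simp)
  have hgc : HasCompactSupport (gradient ψ) := (hc.fderiv (𝕜 := ℝ)).comp_left (map_zero _)
  have hi1 : Integrable (fun x => φ x • gradient ψ x) :=
    (hφ.continuous.smul hψ1.continuous_gradient).integrable_of_hasCompactSupport hgc.smul_left
  have hi2 : Integrable (fun x => ψ x • gradient φ x) :=
    (hψ.continuous.smul hφ1.continuous_gradient).integrable_of_hasCompactSupport hc.smul_right
  refine ext_inner_left ℝ fun v => ?_
  rw [inner_neg_right, ← integral_inner hi1, ← integral_inner hi2]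
  have hin : ∀ (f : EuclideanSpace ℝ (Fin d) → ℝ) x, inner ℝ v (gradient f x) = fderiv ℝ f x v := by
    intro f x
    rw [real_inner_comm, gradient, InnerProductSpace.toDual_symm_apply]
  simp only [inner_smul_right, hin]
  have h := integral_mul_fderiv_eq_neg_fderiv_mul_of_integrable (μ := volume) (f := φ) (g := ψ)
    (v := v) ?_ ?_ ?_ (fun x _ => hφ.differentiable (by simp) x)
    (fun x _ => hψ.differentiable (by simp) x)
  · rw [h]
    simp only [mul_comm]
  · have := hi2.const_inner (𝕜 := ℝ) v
    refine this.congr (Eventually.of_forall fun x => ?_)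
    simp only [inner_smul_right, hin, mul_comm]
  · have := hi1.const_inner (𝕜 := ℝ) v
    refine this.congr (Eventually.of_forall fun x => ?_)
    simp only [inner_smul_right, hin]
  · exact (hφ.continuous.mul hψ.continuous).integrable_of_hasCompactSupport hc.mul_left

theorem isWeakGradient_gradient {d : ℕ} {U : Set (EuclideanSpace ℝ (Fin d))}
    {φ : EuclideanSpace ℝ (Fin d) → ℝ} (hφ : ContDiff ℝ ∞ φ) :
    IsWeakGradient U φ (gradient φ) := by
  intro ψ hψ hc hs
  have hz : ∀ x, x ∉ U → ψ x = 0 := fun x hx => image_eq_zero_of_notMem_tsupport fun h => hx (hs h)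
  have hz' : ∀ x, x ∉ U → gradient ψ x = 0 := by
    intro x hx
    have : fderiv ℝ ψ x = 0 := by
      by_contra h
      exact hx (hs (support_fderiv_subset ℝ h))
    simp [gradient, this]
  rw [setIntegral_eq_integral_of_forall_compl_eq_zero fun x hx => by simp [hz' x hx],
    setIntegral_eq_integral_of_forall_compl_eq_zero fun x hx => by simp [hz x hx]]
  exact integral_smul_gradient hφ hψ hc

/-- Weak gradients are stable under `L²` convergence. -/
theorem isWeakGradient_of_tendsto {d : ℕ} {U : Set (EuclideanSpace ℝ (Fin d))}
    {f : ℕ → Lp ℝ 2 (volume.restrict U)}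
    {G : ℕ → Lp (EuclideanSpace ℝ (Fin d)) 2 (volume.restrict U)}
    {f₀ : Lp ℝ 2 (volume.restrict U)} {G₀ : Lp (EuclideanSpace ℝ (Fin d)) 2 (volume.restrict U)}
    (hfG : ∀ n, IsWeakGradient U (f n) (G n)) (hf : Tendsto f atTop (𝓝 f₀))
    (hG : Tendsto G atTop (𝓝 G₀)) : IsWeakGradient U f₀ G₀ := by
  intro ψ hψ hc hs
  have hψ1 : ContDiff ℝ 1 ψ := hψ.of_le (by simp)
  have hgc : HasCompactSupport (gradient ψ) := (hc.fderiv (𝕜 := ℝ)).comp_left (map_zero _)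
  have hm1 : MemLp (gradient ψ) 2 (volume.restrict U) :=
    (hψ1.continuous_gradient.memLp_of_hasCompactSupport hgc).restrict U
  have hm2 : MemLp ψ 2 (volume.restrict U) :=
    (hψ.continuous.memLp_of_hasCompactSupport hc).restrict U
  let L := (ContinuousLinearMap.lsmul ℝ ℝ (E := EuclideanSpace ℝ (Fin d))).lpPairing
    (volume.restrict U) 2 2
  have hL1 : ∀ h : Lp ℝ 2 (volume.restrict U),
      L h (hm1.toLp _) = ∫ x in U, h x • gradient ψ x := by
    intro h
    rw [ContinuousLinearMap.lpPairing_eq_integral]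
    refine integral_congr_ae ?_
    filter_upwards [hm1.coeFn_toLp] with x hx
    simp [hx]
  have hL2 : ∀ H : Lp (EuclideanSpace ℝ (Fin d)) 2 (volume.restrict U),
      L (hm2.toLp _) H = ∫ x in U, ψ x • H x := by
    intro h
    rw [ContinuousLinearMap.lpPairing_eq_integral]
    refine integral_congr_ae ?_
    filter_upwards [hm2.coeFn_toLp] with x hx
    simp [hx]
  have h1 : Tendsto (fun n => L (f n) (hm1.toLp _)) atTop (𝓝 (L f₀ (hm1.toLp _))) :=
    ((by fun_prop : Continuous fun h => L h (hm1.toLp _)).tendsto f₀).comp hf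
  have h2 : Tendsto (fun n => L (hm2.toLp _) (G n)) atTop (𝓝 (L (hm2.toLp _) G₀)) :=
    ((L (hm2.toLp _)).continuous.tendsto G₀).comp hG
  rw [← hL1, ← hL2]
  refine tendsto_nhds_unique h1 (h2.neg.congr fun n => ?_)
  rw [hL1, hL2]
  exact (hfG n ψ hψ hc hs).symm

end WeakGradient

/-! ### Traces as limits in a Hilbert space -/

section ProdMap

variable {M A B : Type*} [AddCommGroup M] [Module ℝ M] [NormedAddCommGroup A]
  [InnerProductSpace ℝ A] [NormedAddCommGroup B] [InnerProductSpace ℝ B]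

/-- The pairing of two linear maps, with values in the Hilbert sum of the targets. -/
def hilbertProd (S : M →ₗ[ℝ] A) (T : M →ₗ[ℝ] B) : M →ₗ[ℝ] WithLp 2 (A × B) :=
  (WithLp.linearEquiv 2 ℝ (A × B)).symm.toLinearMap.comp (S.prod T)

theorem norm_sq_hilbertProd (S : M →ₗ[ℝ] A) (T : M →ₗ[ℝ] B) (m : M) :
    ‖hilbertProd S T m‖ ^ 2 = ‖S m‖ ^ 2 + ‖T m‖ ^ 2 := by
  rw [WithLp.prod_norm_sq_eq_of_L2]
  rfl

theorem tendsto_hilbertProd {S : M →ₗ[ℝ] A} {T : M →ₗ[ℝ] B} {φ : ℕ → M} {a : A} {b : B} :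
    Tendsto (fun n => hilbertProd S T (φ n)) atTop (𝓝 (WithLp.toLp 2 (a, b))) ↔
      Tendsto (fun n => S (φ n)) atTop (𝓝 a) ∧ Tendsto (fun n => T (φ n)) atTop (𝓝 b) := by
  constructor
  · intro h
    exact ⟨((WithLp.fstL 2 ℝ A B).continuous.tendsto _).comp h,
      ((WithLp.sndL 2 ℝ A B).continuous.tendsto _).comp h⟩
  · rintro ⟨h1, h2⟩
    exact ((WithLp.prod_continuous_toLp 2 A B).tendsto (a, b)).comp (h1.prodMk_nhds h2)

end ProdMap

section Traces

variable {d : ℕ} {U S S' : Set (EuclideanSpace ℝ (Fin d))}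
  (hμ : ∀ φ : EuclideanSpace ℝ (Fin d) → ℝ, ContDiff ℝ ∞ φ → MemLp φ 2 (volume.restrict U))
  (hg : ∀ φ : EuclideanSpace ℝ (Fin d) → ℝ, ContDiff ℝ ∞ φ →
    MemLp (gradient φ) 2 (volume.restrict U))
  (hS : ∀ φ : EuclideanSpace ℝ (Fin d) → ℝ, ContDiff ℝ ∞ φ → MemLp φ 2 (surfaceMeasure S))
  (hS' : ∀ φ : EuclideanSpace ℝ (Fin d) → ℝ, ContDiff ℝ ∞ φ → MemLp φ 2 (surfaceMeasure S'))

/-- The embedding `φ ↦ (φ, ∇φ)` of smooth functions into `L² × L²`, which carries the `H¹` norm. -/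
noncomputable def sobolevMap : smoothFunctions (EuclideanSpace ℝ (Fin d)) →ₗ[ℝ]
    WithLp 2 (Lp ℝ 2 (volume.restrict U) × Lp (EuclideanSpace ℝ (Fin d)) 2 (volume.restrict U)) :=
  hilbertProd (toL2 _ hμ) (gradL2 _ hg)

theorem hasTrace_iff {u : SobolevH1 U} {t : Lp ℝ 2 (surfaceMeasure S)} :
    HasTrace S u t ↔ ∃ φ : ℕ → smoothFunctions (EuclideanSpace ℝ (Fin d)),
      Tendsto (fun n => sobolevMap hμ hg (φ n)) atTop (𝓝 (WithLp.toLp 2 (u.val, u.grad))) ∧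
      Tendsto (fun n => toL2 _ hS (φ n)) atTop (𝓝 t) := by
  have key : ∀ (F : Type) [NormedAddCommGroup F] (ν : Measure (EuclideanSpace ℝ (Fin d)))
      (f : ℕ → EuclideanSpace ℝ (Fin d) → F) (hf : ∀ n, MemLp (f n) 2 ν) (f₀ : Lp F 2 ν),
      Tendsto (fun n => (hf n).toLp (f n)) atTop (𝓝 f₀) ↔
        Tendsto (fun n => eLpNorm (fun x => f n x - f₀ x) 2 ν) atTop (𝓝 0) := by
    intro F _ ν f hf f₀
    have h := Lp.tendsto_Lp_iff_tendsto_eLpNorm'' (fi := atTop) f hf f₀ (Lp.memLp f₀)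
    rw [Lp.toLp_coeFn] at h
    exact h
  constructor
  · rintro ⟨φ, hφ, h1, h2, h3⟩
    refine ⟨fun n => ⟨φ n, hφ n⟩, tendsto_hilbertProd.2 ⟨?_, ?_⟩, ?_⟩
    · exact (key _ _ _ (fun n => hμ _ (hφ n)) _).2 h1
    · exact (key _ _ _ (fun n => hg _ (hφ n)) _).2 h2
    · exact (key _ _ _ (fun n => hS _ (hφ n)) _).2 h3
  · rintro ⟨φ, h12, h3⟩
    obtain ⟨h1, h2⟩ := tendsto_hilbertProd.1 h12
    exact ⟨fun n => φ n, fun n => (φ n).2, (key _ _ _ (fun n => hμ _ (φ n).2) _).1 h1,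
      (key _ _ _ (fun n => hg _ (φ n).2) _).1 h2, (key _ _ _ (fun n => hS _ (φ n).2) _).1 h3⟩

variable {hμ hg hS hS'} {C : ℝ}

/-- Two smooth approximations of `u` differ by a null sequence in `H¹`, so by the trace inequality
`hC` their restrictions to `S` have the same limit. -/
theorem HasTrace.unique (hC : ∀ φ, ‖toL2 _ hS φ‖ ≤ C * ‖sobolevMap hμ hg φ‖) {u : SobolevH1 U}
    {t t' : Lp ℝ 2 (surfaceMeasure S)} (h : HasTrace S u t) (h' : HasTrace S u t') : t = t' := by
  obtain ⟨φ, hφ, hφt⟩ := (hasTrace_iff hμ hg hS).1 h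
  obtain ⟨ψ, hψ, hψt⟩ := (hasTrace_iff hμ hg hS).1 h'
  exact tendsto_nhds_unique hφt (tendsto_of_dominated hC hφ hψ hψt)

/-- A function with a trace on one set is a limit of smooth functions, so it has a trace on every
other set for which a trace inequality holds. -/
theorem HasTrace.exists_trace (hC : ∀ φ, ‖toL2 _ hS' φ‖ ≤ C * ‖sobolevMap hμ hg φ‖)
    (hS : ∀ φ : EuclideanSpace ℝ (Fin d) → ℝ, ContDiff ℝ ∞ φ → MemLp φ 2 (surfaceMeasure S))
    {u : SobolevH1 U} {t : Lp ℝ 2 (surfaceMeasure S)} (h : HasTrace S u t) :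
    ∃ t', HasTrace S' u t' := by
  obtain ⟨φ, hφ, -⟩ := (hasTrace_iff hμ hg hS).1 h
  obtain ⟨t', ht'⟩ := exists_tendsto_of_dominated hC hφ
  exact ⟨t', (hasTrace_iff hμ hg hS').2 ⟨φ, hφ, ht'⟩⟩

end Traces

section NormBounds

variable {E : Type*} [NormedAddCommGroup E] [InnerProductSpace ℝ E]
  [MeasurableSpace E] {ν : Measure E}

theorem ofReal_norm_toL2_sq (h : ∀ φ : E → ℝ, ContDiff ℝ ∞ φ → MemLp φ 2 ν)
    (φ : smoothFunctions E) :
    ENNReal.ofReal (‖toL2 ν h φ‖ ^ 2) = ∫⁻ x, ‖(φ : E → ℝ) x‖ₑ ^ 2 ∂ν := by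
  rw [ofReal_norm_sq_Lp]
  refine lintegral_congr_ae ?_
  filter_upwards [coeFn_toL2 ν h φ] with x hx
  rw [hx]

theorem ofReal_norm_gradL2_sq [CompleteSpace E]
    (h : ∀ φ : E → ℝ, ContDiff ℝ ∞ φ → MemLp (gradient φ) 2 ν)
    (φ : smoothFunctions E) :
    ENNReal.ofReal (‖gradL2 ν h φ‖ ^ 2) = ∫⁻ x, ‖gradient (φ : E → ℝ) x‖ₑ ^ 2 ∂ν := by
  rw [ofReal_norm_sq_Lp]
  refine lintegral_congr_ae ?_
  filter_upwards [coeFn_gradL2 ν h φ] with x hx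
  rw [hx]

theorem le_of_ofReal_le_coe_mul {a b c : ℝ} (hb : 0 ≤ b) (hc : 0 ≤ c) {C : NNReal}
    (h : ENNReal.ofReal a ≤ C * (ENNReal.ofReal b + ENNReal.ofReal c)) : a ≤ C * (b + c) := by
  rw [← ENNReal.ofReal_add hb hc, ← ENNReal.ofReal_coe_nnreal,
    ← ENNReal.ofReal_mul (NNReal.coe_nonneg C)] at h
  exact (ENNReal.ofReal_le_ofReal_iff (by positivity)).1 h

theorem norm_toL2_le_sobolevMap {d : ℕ} {U S : Set (EuclideanSpace ℝ (Fin d))}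
    (hμ : ∀ φ : EuclideanSpace ℝ (Fin d) → ℝ, ContDiff ℝ ∞ φ → MemLp φ 2 (volume.restrict U))
    (hg : ∀ φ : EuclideanSpace ℝ (Fin d) → ℝ, ContDiff ℝ ∞ φ →
      MemLp (gradient φ) 2 (volume.restrict U))
    (hS : ∀ φ : EuclideanSpace ℝ (Fin d) → ℝ, ContDiff ℝ ∞ φ → MemLp φ 2 (surfaceMeasure S))
    {C : NNReal} (hC : ∀ φ : EuclideanSpace ℝ (Fin d) → ℝ, ContDiff ℝ 1 φ →
      ∫⁻ x, ‖φ x‖ₑ ^ 2 ∂surfaceMeasure S ≤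
        C * ((∫⁻ x in U, ‖φ x‖ₑ ^ 2) + ∫⁻ x in U, ‖gradient φ x‖ₑ ^ 2))
    (φ : smoothFunctions (EuclideanSpace ℝ (Fin d))) :
    ‖toL2 _ hS φ‖ ≤ √C * ‖sobolevMap hμ hg φ‖ := by
  have hφ : ContDiff ℝ ∞ (φ : EuclideanSpace ℝ (Fin d) → ℝ) := φ.2
  have h := hC φ (hφ.of_le (by simp))
  rw [← ofReal_norm_toL2_sq hS, ← ofReal_norm_toL2_sq hμ, ← ofReal_norm_gradL2_sq hg] at h
  have h' := le_of_ofReal_le_coe_mul (by positivity) (by positivity) h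
  refine abs_le_of_sq_le_sq' ?_ (by positivity) |>.2
  rw [mul_pow, Real.sq_sqrt (NNReal.coe_nonneg C), sobolevMap, norm_sq_hilbertProd]
  exact h'

end NormBounds

/-! ### Well-posedness of the Robin transmission problem -/

theorem real_inner_eq_mul (a b : ℝ) : inner ℝ a b = a * b := by
  simp [mul_comm]

/-- Lax–Milgram for an energy made of a coercive form in `D` (a gradient) and one in `T₁` (a
boundary value), when these control `S` (the function) and `T₂` (the data side boundary value). The
solution and the admissible test elements are limits of values of the maps. -/
theorem exists_variational_solution {M H G B₁ B₂ : Type*} [AddCommGroup M] [Module ℝ M]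
    [NormedAddCommGroup H] [InnerProductSpace ℝ H] [CompleteSpace H]
    [NormedAddCommGroup G] [InnerProductSpace ℝ G] [CompleteSpace G]
    [NormedAddCommGroup B₁] [InnerProductSpace ℝ B₁] [CompleteSpace B₁]
    [NormedAddCommGroup B₂] [InnerProductSpace ℝ B₂] [CompleteSpace B₂]
    (S : M →ₗ[ℝ] H) (D : M →ₗ[ℝ] G) (T₁ : M →ₗ[ℝ] B₁) (T₂ : M →ₗ[ℝ] B₂)
    (a : G →L[ℝ] G →L[ℝ] ℝ) (b : B₁ →L[ℝ] B₁ →L[ℝ] ℝ) {ca cb C C₂ : ℝ} (hca : 0 < ca)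
    (hcb : 0 < cb) (ha : ∀ x, ca * ‖x‖ ^ 2 ≤ a x x) (hb : ∀ x, cb * ‖x‖ ^ 2 ≤ b x x) (hC : 0 ≤ C)
    (hP : ∀ φ, ‖S φ‖ ^ 2 ≤ C * (‖D φ‖ ^ 2 + ‖T₁ φ‖ ^ 2))
    (hT₂ : ∀ φ, ‖T₂ φ‖ ≤ C₂ * ‖hilbertProd S D φ‖) (g : B₂) :
    ∃ (φ : ℕ → M) (u : H) (p : G) (t₁ : B₁) (t₂ : B₂),
      Tendsto (fun n => hilbertProd S D (φ n)) atTop (𝓝 (WithLp.toLp 2 (u, p))) ∧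
      Tendsto (fun n => T₁ (φ n)) atTop (𝓝 t₁) ∧ Tendsto (fun n => T₂ (φ n)) atTop (𝓝 t₂) ∧
      ∀ (ψ : ℕ → M) (w : H) (q : G) (s₁ : B₁) (s₂ : B₂),
        Tendsto (fun n => hilbertProd S D (ψ n)) atTop (𝓝 (WithLp.toLp 2 (w, q))) →
        Tendsto (fun n => T₁ (ψ n)) atTop (𝓝 s₁) → Tendsto (fun n => T₂ (ψ n)) atTop (𝓝 s₂) →
        a p q + b t₁ s₁ = inner ℝ g s₂ := by
  let J := hilbertProd (hilbertProd S D) (hilbertProd T₁ T₂)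
  let pD := (WithLp.sndL 2 ℝ H G).comp (WithLp.fstL 2 ℝ (WithLp 2 (H × G)) (WithLp 2 (B₁ × B₂)))
  let pB := WithLp.sndL 2 ℝ (WithLp 2 (H × G)) (WithLp 2 (B₁ × B₂))
  let p₁ := (WithLp.fstL 2 ℝ B₁ B₂).comp pB
  let p₂ := (WithLp.sndL 2 ℝ B₁ B₂).comp pB
  let B := a.bilinearComp pD pD + b.bilinearComp p₁ p₁
  have hcoer : ∀ φ, min ca cb / ((1 + C₂ ^ 2) * (C + 1)) * ‖J φ‖ ^ 2 ≤ B (J φ) (J φ) := by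
    intro φ
    have hJ : ‖J φ‖ ^ 2 = ‖S φ‖ ^ 2 + ‖D φ‖ ^ 2 + (‖T₁ φ‖ ^ 2 + ‖T₂ φ‖ ^ 2) := by
      simp only [J, norm_sq_hilbertProd]
    have h2 : ‖T₂ φ‖ ^ 2 ≤ C₂ ^ 2 * (‖S φ‖ ^ 2 + ‖D φ‖ ^ 2) := by
      rw [← norm_sq_hilbertProd, ← mul_pow]
      exact pow_le_pow_left₀ (norm_nonneg _) (hT₂ φ) 2
    have h3 := hP φ
    have h4 := ha (D φ)
    have h5 := hb (T₁ φ)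
    have hB : B (J φ) (J φ) = a (D φ) (D φ) + b (T₁ φ) (T₁ φ) := rfl
    rw [hB, hJ, div_mul_eq_mul_div, div_le_iff₀ (by positivity)]
    have hD0 : 0 ≤ ‖D φ‖ ^ 2 := by positivity
    have hT0 : 0 ≤ ‖T₁ φ‖ ^ 2 := by positivity
    generalize ‖S φ‖ ^ 2 = x at *
    generalize ‖D φ‖ ^ 2 = y at *
    generalize ‖T₁ φ‖ ^ 2 = z at *
    generalize ‖T₂ φ‖ ^ 2 = f at *
    have hsum : x + y + (z + f) ≤ (y + z) * ((1 + C₂ ^ 2) * (C + 1)) := by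
      have h6 : (1 + C₂ ^ 2) * x ≤ (1 + C₂ ^ 2) * (C * (y + z)) := by gcongr
      nlinarith [mul_nonneg (sq_nonneg C₂) hT0]
    have hmin : 0 ≤ min ca cb := by positivity
    have h7 : min ca cb * y ≤ ca * y := by gcongr; exact min_le_left _ _
    have h8 : min ca cb * z ≤ cb * z := by gcongr; exact min_le_right _ _
    calc min ca cb * (x + y + (z + f))
        ≤ min ca cb * ((y + z) * ((1 + C₂ ^ 2) * (C + 1))) := by gcongr
      _ = (min ca cb * (y + z)) * ((1 + C₂ ^ 2) * (C + 1)) := by ring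
      _ ≤ _ := by
          refine mul_le_mul_of_nonneg_right ?_ (by positivity)
          linarith
  obtain ⟨v, hv, hvw⟩ := exists_mem_closure_range_forall_eq J B (by positivity) hcoer
    ((innerSL ℝ g).comp p₂)
  obtain ⟨x, hx, hxv⟩ := mem_closure_iff_seq_limit.1 hv
  choose φ hφ using hx
  obtain rfl : (fun n => J (φ n)) = x := funext hφ
  obtain ⟨h12, h34⟩ := tendsto_hilbertProd.1
    (show Tendsto (fun n => J (φ n)) atTop (𝓝 (WithLp.toLp 2 (v.fst, v.snd))) from hxv)
  obtain ⟨h3, h4⟩ := tendsto_hilbertProd.1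
    (show Tendsto (fun n => hilbertProd T₁ T₂ (φ n)) atTop
      (𝓝 (WithLp.toLp 2 (v.snd.fst, v.snd.snd))) from h34)
  refine ⟨φ, v.fst.fst, v.fst.snd, v.snd.fst, v.snd.snd, h12, h3, h4, ?_⟩
  intro ψ w q s₁ s₂ hψ hψ₁ hψ₂
  exact hvw _ (mem_closure_of_tendsto
    (tendsto_hilbertProd.2 ⟨hψ, tendsto_hilbertProd.2 ⟨hψ₁, hψ₂⟩⟩)
    (Eventually.of_forall fun n => ⟨ψ n, rfl⟩))

/-- The variational formulation in terms of bounded bilinear forms on `L²` spaces. -/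
theorem isRobinSolution_iff {d : ℕ} {Ω Ω₁ : Set (EuclideanSpace ℝ (Fin d))} {σ₁ σ₂ : ℝ}
    {m : Lp ℝ ∞ (volume.restrict Ω)}
    (hm : ∀ᵐ x ∂volume.restrict Ω, m x = conductivity Ω Ω₁ σ₁ σ₂ x)
    {γ : Lp ℝ ∞ (surfaceMeasure (frontier Ω₁))} {g : Lp ℝ 2 (surfaceMeasure (frontier Ω))}
    {u : SobolevH1 Ω} :
    IsRobinSolution Ω Ω₁ σ₁ σ₂ γ g u ↔
      ∃ uΓ : Lp ℝ 2 (surfaceMeasure (frontier Ω₁)), HasTrace (frontier Ω₁) u uΓ ∧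
        ∀ (w : SobolevH1 Ω) (wΓ : Lp ℝ 2 (surfaceMeasure (frontier Ω₁)))
          (wb : Lp ℝ 2 (surfaceMeasure (frontier Ω))),
          HasTrace (frontier Ω₁) w wΓ → HasTrace (frontier Ω) w wb →
          weightedForm m u.grad w.grad + weightedForm γ uΓ wΓ = inner ℝ g wb := by
  unfold IsRobinSolution
  refine exists_congr fun uΓ => and_congr_right fun _ => forall_congr' fun w =>
    forall_congr' fun wΓ => forall_congr' fun wb => forall_congr' fun _ => forall_congr' fun _ => ?_
  rw [weightedForm_apply, weightedForm_apply, L2.inner_def]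
  have e1 : ∫ x in Ω, conductivity Ω Ω₁ σ₁ σ₂ x * inner ℝ (u.grad x) (w.grad x) =
      ∫ x in Ω, m x * inner ℝ (u.grad x) (w.grad x) := by
    refine integral_congr_ae ?_
    filter_upwards [hm] with x hx
    rw [hx]
  simp only [e1, real_inner_eq_mul, mul_assoc]

/-- Existence of a solution that also has a trace on `∂Ω`, from the trace inequality `hT₂`, the
Poincaré inequality `hP` and the positive lower bounds of `σ` and `γ`. -/
theorem exists_isRobinSolution {d : ℕ} {Ω Ω₁ : Set (EuclideanSpace ℝ (Fin d))} {σ₁ σ₂ : ℝ}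
    (hμ : ∀ φ : EuclideanSpace ℝ (Fin d) → ℝ, ContDiff ℝ ∞ φ → MemLp φ 2 (volume.restrict Ω))
    (hg : ∀ φ : EuclideanSpace ℝ (Fin d) → ℝ, ContDiff ℝ ∞ φ →
      MemLp (gradient φ) 2 (volume.restrict Ω))
    (hΓ : ∀ φ : EuclideanSpace ℝ (Fin d) → ℝ, ContDiff ℝ ∞ φ →
      MemLp φ 2 (surfaceMeasure (frontier Ω₁)))
    (hb : ∀ φ : EuclideanSpace ℝ (Fin d) → ℝ, ContDiff ℝ ∞ φ →
      MemLp φ 2 (surfaceMeasure (frontier Ω)))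
    {C₂ C : ℝ}
    (hT₂ : ∀ φ, ‖toL2 _ hb φ‖ ≤ C₂ * ‖sobolevMap hμ hg φ‖) (hC : 0 ≤ C)
    (hP : ∀ φ, ‖toL2 _ hμ φ‖ ^ 2 ≤ C * (‖gradL2 _ hg φ‖ ^ 2 + ‖toL2 _ hΓ φ‖ ^ 2))
    {m : Lp ℝ ∞ (volume.restrict Ω)}
    (hm : ∀ᵐ x ∂volume.restrict Ω, m x = conductivity Ω Ω₁ σ₁ σ₂ x)
    {c : ℝ} (hc : 0 < c) (hcm : ∀ᵐ x ∂volume.restrict Ω, c ≤ m x)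
    {γ : Lp ℝ ∞ (surfaceMeasure (frontier Ω₁))} (hγ : γ ∈ LInftyPos (frontier Ω₁))
    (g : Lp ℝ 2 (surfaceMeasure (frontier Ω))) :
    ∃ t : Lp ℝ 2 (surfaceMeasure (frontier Ω)), ∃ u : SobolevH1 Ω,
      IsRobinSolution Ω Ω₁ σ₁ σ₂ γ g u ∧ HasTrace (frontier Ω) u t := by
  obtain ⟨cγ, hcγ, hγc⟩ := hγ
  obtain ⟨φ, u₀, p, t₁, t₂, h12, h3, h4, hvar⟩ := exists_variational_solution (toL2 _ hμ)
    (gradL2 _ hg) (toL2 _ hΓ) (toL2 _ hb) (weightedForm m) (weightedForm γ) hc hcγ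
    (mul_norm_sq_le_weightedForm hcm) (mul_norm_sq_le_weightedForm hγc) hC hP hT₂ g
  obtain ⟨h1, h2⟩ := tendsto_hilbertProd.1 h12
  have hweak : ∀ ψ, IsWeakGradient Ω (toL2 _ hμ ψ) (gradL2 _ hg ψ) := by
    intro ψ χ hχ hχc hχs
    rw [integral_congr_ae (g := fun x => (ψ : EuclideanSpace ℝ (Fin d) → ℝ) x • gradient χ x),
      integral_congr_ae (f := fun x => χ x • gradL2 _ hg ψ x)
        (g := fun x => χ x • gradient (ψ : EuclideanSpace ℝ (Fin d) → ℝ) x)]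
    · exact isWeakGradient_gradient ψ.2 χ hχ hχc hχs
    · filter_upwards [coeFn_gradL2 _ hg ψ] with x hx
      rw [hx]
    · filter_upwards [coeFn_toL2 _ hμ ψ] with x hx
      rw [hx]
  let u : SobolevH1 Ω := ⟨u₀, p, isWeakGradient_of_tendsto (fun n => hweak (φ n)) h1 h2⟩
  refine ⟨t₂, u, (isRobinSolution_iff hm).2 ⟨t₁, (hasTrace_iff hμ hg hΓ).2 ⟨φ, h12, h3⟩, ?_⟩,
    (hasTrace_iff hμ hg hb).2 ⟨φ, h12, h4⟩⟩
  intro w wΓ wb hwΓ hwb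
  obtain ⟨ψ, hψ, hψΓ⟩ := (hasTrace_iff hμ hg hΓ).1 hwΓ
  obtain ⟨χ, hχ, hχb⟩ := (hasTrace_iff hμ hg hb).1 hwb
  -- The two traces of `w` come with different smooth approximations; `hT₂` allows `ψ` for both.
  exact hvar ψ _ _ _ _ hψ hψΓ (tendsto_of_dominated hT₂ hψ hχ hχb)

/-! ### The Neumann-to-Dirichlet map -/

/-- When a solution with a trace on `∂Ω` exists, the Neumann-to-Dirichlet map takes the trace of
such a solution and not its default value. -/
theorem exists_robinSolution_neumannToDirichlet {d : ℕ} {Ω Ω₁ : Set (EuclideanSpace ℝ (Fin d))}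
    {σ₁ σ₂ : ℝ} {γ : Lp ℝ ∞ (surfaceMeasure (frontier Ω₁))}
    {g : Lp ℝ 2 (surfaceMeasure (frontier Ω))}
    (h : ∃ t : Lp ℝ 2 (surfaceMeasure (frontier Ω)), ∃ u : SobolevH1 Ω,
      IsRobinSolution Ω Ω₁ σ₁ σ₂ γ g u ∧ HasTrace (frontier Ω) u t) :
    ∃ u : SobolevH1 Ω, IsRobinSolution Ω Ω₁ σ₁ σ₂ γ g u ∧
      HasTrace (frontier Ω) u (neumannToDirichlet Ω Ω₁ σ₁ σ₂ γ g) := by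
  rw [neumannToDirichlet, dif_pos h]
  exact h.choose_spec

theorem integral_mul_sub_eq_inner {α : Type*} [MeasurableSpace α] {ν : Measure α}
    (g s t : Lp ℝ 2 ν) : ∫ x, g x * (s x - t x) ∂ν = inner ℝ g s - inner ℝ g t := by
  rw [← inner_sub_right, L2.inner_def]
  refine integral_congr_ae ?_
  filter_upwards [Lp.coeFn_sub s t] with x hx
  simp only [real_inner_eq_mul, hx, Pi.sub_apply]

theorem integral_mul_eq_inner {α : Type*} [MeasurableSpace α] {ν : Measure α}
    (g s : Lp ℝ 2 ν) : ∫ x, g x * s x ∂ν = inner ℝ g s := by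
  rw [L2.inner_def]
  simp only [real_inner_eq_mul]

/-! ### The conductivity -/

theorem measurable_conductivity {d : ℕ} {Ω Ω₁ : Set (EuclideanSpace ℝ (Fin d))} (σ₁ σ₂ : ℝ)
    (hΩ : IsOpen Ω) (hΩ₁ : IsOpen Ω₁) : Measurable (conductivity Ω Ω₁ σ₁ σ₂) :=
  (measurable_const.indicator hΩ₁.measurableSet).add
    (measurable_const.indicator (hΩ.measurableSet.diff isClosed_closure.measurableSet))

theorem abs_conductivity_le {d : ℕ} {Ω Ω₁ : Set (EuclideanSpace ℝ (Fin d))} {σ₁ σ₂ : ℝ}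
    (hσ₁ : 0 ≤ σ₁) (hσ₂ : 0 ≤ σ₂) (x : EuclideanSpace ℝ (Fin d)) :
    |conductivity Ω Ω₁ σ₁ σ₂ x| ≤ σ₁ + σ₂ := by
  have h1 : Ω₁.indicator (fun _ => σ₁) x ≤ σ₁ := Set.indicator_le_self' (fun _ _ => hσ₁) x
  have h2 : (Ω \ closure Ω₁).indicator (fun _ => σ₂) x ≤ σ₂ :=
    Set.indicator_le_self' (fun _ _ => hσ₂) x
  have h3 : 0 ≤ Ω₁.indicator (fun _ => σ₁) x := Set.indicator_nonneg (fun _ _ => hσ₁) x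
  have h4 : 0 ≤ (Ω \ closure Ω₁).indicator (fun _ => σ₂) x :=
    Set.indicator_nonneg (fun _ _ => hσ₂) x
  rw [conductivity, abs_of_nonneg (by positivity)]
  linarith

/-- The conductivity vanishes on `Γ`, which the bound has to exclude. -/
theorem min_le_conductivity {d : ℕ} {Ω Ω₁ : Set (EuclideanSpace ℝ (Fin d))} {σ₁ σ₂ : ℝ}
    (hΩ₁ : IsOpen Ω₁) {x : EuclideanSpace ℝ (Fin d)} (hx : x ∈ Ω) (hxΓ : x ∉ frontier Ω₁) :
    min σ₁ σ₂ ≤ conductivity Ω Ω₁ σ₁ σ₂ x := by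
  rw [conductivity]
  by_cases h : x ∈ Ω₁
  · have h' : x ∉ Ω \ closure Ω₁ := fun h' => h'.2 (subset_closure h)
    simp [Set.indicator_of_mem h, Set.indicator_of_notMem h']
  · have h' : x ∈ Ω \ closure Ω₁ :=
      ⟨hx, fun hc => hxΓ (by rw [hΩ₁.frontier_eq]; exact ⟨hc, h⟩)⟩
    rw [Set.indicator_of_notMem h, Set.indicator_of_mem h', zero_add]
    exact min_le_right _ _

/-! ### The two energy inequalities -/

section EnergyInequalities

variable {α : Type*} [MeasurableSpace α] {ν : Measure α}

theorem integral_sub_mul_sq_eq (γ₁ γ₂ : Lp ℝ ∞ ν) (a : Lp ℝ 2 ν) :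
    ∫ x, (γ₁ x - γ₂ x) * a x ^ 2 ∂ν = weightedForm γ₁ a a - weightedForm γ₂ a a := by
  rw [weightedForm_apply, weightedForm_apply,
    ← integral_sub (integrable_weightedForm γ₁ a a) (integrable_weightedForm γ₂ a a)]
  refine integral_congr_ae (Eventually.of_forall fun x => ?_)
  simp only [real_inner_eq_mul]
  ring

/-- Completing the square in `b` under the integral. -/
theorem integral_sub_sq_div_mul_sq_le {γ₁ : Lp ℝ ∞ ν} (γ₂ : Lp ℝ ∞ ν) {c : ℝ} (hc : 0 < c)
    (hγ₁ : ∀ᵐ x ∂ν, c ≤ γ₁ x) (a b : Lp ℝ 2 ν) :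
    ∫ x, (γ₂ x - γ₂ x ^ 2 / γ₁ x) * a x ^ 2 ∂ν ≤
      weightedForm γ₂ a a - 2 * weightedForm γ₂ a b + weightedForm γ₁ b b := by
  have hi22 := integrable_weightedForm γ₂ a a
  have hi2 := integrable_weightedForm γ₂ a b
  have hi1 := integrable_weightedForm γ₁ b b
  have hM : ∀ᵐ x ∂ν, ‖γ₂ x / γ₁ x‖ ≤ ‖γ₂‖ / c := by
    filter_upwards [ae_le_eLpNormEssSup (f := γ₂) (μ := ν), hγ₁] with x hx hx'
    rw [← eLpNorm_exponent_top, ← Lp.enorm_def, enorm_le_iff_norm_le] at hx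
    rw [norm_div, Real.norm_of_nonneg (hc.le.trans hx')]
    gcongr
  have hmeas : AEStronglyMeasurable (fun x => γ₂ x / γ₁ x) ν :=
    ((Lp.aestronglyMeasurable γ₂).aemeasurable.div
      (Lp.aestronglyMeasurable γ₁).aemeasurable).aestronglyMeasurable
  have hi : Integrable (fun x => (γ₂ x - γ₂ x ^ 2 / γ₁ x) * a x ^ 2) ν := by
    refine (hi22.sub (hi22.bdd_mul hmeas hM)).congr (Eventually.of_forall fun x => ?_)
    simp only [real_inner_eq_mul, Pi.sub_apply]
    ring
  have hi3 : Integrable (fun x => γ₂ x * inner ℝ (a x) (a x) -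
      2 * (γ₂ x * inner ℝ (a x) (b x))) ν := hi22.sub (hi2.const_mul 2)
  rw [weightedForm_apply, weightedForm_apply, weightedForm_apply, ← integral_const_mul,
    ← integral_sub hi22 (hi2.const_mul 2), ← integral_add hi3 hi1]
  refine integral_mono_ae hi (hi3.add hi1) ?_
  filter_upwards [hγ₁] with x hx
  have hpos : 0 < γ₁ x := hc.trans_le hx
  simp only [real_inner_eq_mul]
  have hsq : γ₂ x * (a x * a x) - 2 * (γ₂ x * (a x * b x)) + γ₁ x * (b x * b x) -
      (γ₂ x - γ₂ x ^ 2 / γ₁ x) * a x ^ 2 = γ₁ x * (b x - γ₂ x / γ₁ x * a x) ^ 2 := by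
    field_simp
    ring
  have : 0 ≤ γ₁ x * (b x - γ₂ x / γ₁ x * a x) ^ 2 := by positivity
  linarith

theorem weightedForm_sub_sub {F : Type*} [NormedAddCommGroup F] [InnerProductSpace ℝ F]
    (m : Lp ℝ ∞ ν) (p q : Lp F 2 ν) :
    weightedForm m (p - q) (p - q) =
      weightedForm m p p - 2 * weightedForm m p q + weightedForm m q q := by
  simp only [map_sub, sub_apply]
  rw [weightedForm_comm m q p]
  ring

theorem weightedForm_self_nonneg {F : Type*} [NormedAddCommGroup F] [InnerProductSpace ℝ F]
    {m : Lp ℝ ∞ ν} {c : ℝ} (hc : 0 ≤ c) (hm : ∀ᵐ x ∂ν, c ≤ m x) (p : Lp F 2 ν) :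
    0 ≤ weightedForm m p p :=
  le_trans (by positivity) (mul_norm_sq_le_weightedForm hm p)

end EnergyInequalities

/-! ### Monotonicity of the Neumann-to-Dirichlet map -/

/-- The trace inequality for the constant function `1`. -/
theorem isFiniteMeasure_surfaceMeasure_frontier {d : ℕ}
    {U : Set (EuclideanSpace ℝ (Fin d))} (hU : IsOpen U) (hb : Bornology.IsBounded U)
    (hL : HasLipschitzBoundary U) : IsFiniteMeasure (surfaceMeasure (frontier U)) := by
  obtain ⟨C, hC⟩ := hL.exists_lintegral_frontier_le hU hb
  have h := hC (fun _ => 1) contDiff_const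
  have hgrad : ∀ x : EuclideanSpace ℝ (Fin d),
      gradient (fun _ : EuclideanSpace ℝ (Fin d) => (1 : ℝ)) x = 0 := by
    intro x
    simp [gradient]
  simp only [enorm_one, one_pow, lintegral_const, one_mul, hgrad, enorm_zero, ne_eq,
    OfNat.ofNat_ne_zero, not_false_eq_true, zero_pow, zero_mul, add_zero] at h
  refine ⟨h.trans_lt (ENNReal.mul_lt_top ENNReal.coe_lt_top ?_)⟩
  rw [Measure.restrict_apply_univ]
  exact hb.measure_lt_top

theorem lemma4p1 {d : ℕ} (hd : 2 ≤ d) (Ω Ω₁ : Set (EuclideanSpace ℝ (Fin d))) (σ₁ σ₂ : ℝ)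
    (hΩ_open : IsOpen Ω) (hΩ_conn : IsConnected Ω) (hΩ_bdd : Bornology.IsBounded Ω)
    (hΩ_lip : HasLipschitzBoundary Ω)
    (hΩ₁_open : IsOpen Ω₁) (hΩ₁_ne : Ω₁.Nonempty) (hΩ₁_sub : closure Ω₁ ⊆ Ω)
    (hΩ₁_lip : HasLipschitzBoundary Ω₁)
    (hΩ₂_conn : IsConnected (Ω \ closure Ω₁))
    (hσ₁ : 0 < σ₁) (hσ₂ : 0 < σ₂) :
    (∀ γ₁ ∈ LInftyPos (frontier Ω₁), ∀ γ₂ ∈ LInftyPos (frontier Ω₁),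
      ∀ (g : Lp ℝ 2 (surfaceMeasure (frontier Ω))) (u₂ : SobolevH1 Ω)
        (u₂Γ : Lp ℝ 2 (surfaceMeasure (frontier Ω₁))),
      IsRobinSolution Ω Ω₁ σ₁ σ₂ γ₂ g u₂ → HasTrace (frontier Ω₁) u₂ u₂Γ →
      (∫ x, g x * (neumannToDirichlet Ω Ω₁ σ₁ σ₂ γ₂ g x
            - neumannToDirichlet Ω Ω₁ σ₁ σ₂ γ₁ g x) ∂surfaceMeasure (frontier Ω)
          ≤ ∫ x, (γ₁ x - γ₂ x) * u₂Γ x ^ 2 ∂surfaceMeasure (frontier Ω₁)) ∧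
      (∫ x, (γ₂ x - γ₂ x ^ 2 / γ₁ x) * u₂Γ x ^ 2 ∂surfaceMeasure (frontier Ω₁)
          ≤ ∫ x, g x * (neumannToDirichlet Ω Ω₁ σ₁ σ₂ γ₂ g x
            - neumannToDirichlet Ω Ω₁ σ₁ σ₂ γ₁ g x) ∂surfaceMeasure (frontier Ω))) ∧
    (∀ γ₁ ∈ LInftyPos (frontier Ω₁), ∀ γ₂ ∈ LInftyPos (frontier Ω₁), γ₁ ≤ γ₂ →
      ∀ g : Lp ℝ 2 (surfaceMeasure (frontier Ω)),
        ∫ x, g x * neumannToDirichlet Ω Ω₁ σ₁ σ₂ γ₂ g x ∂surfaceMeasure (frontier Ω)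
          ≤ ∫ x, g x * neumannToDirichlet Ω Ω₁ σ₁ σ₂ γ₁ g x ∂surfaceMeasure (frontier Ω)) := by
  have hsub : Ω₁ ⊆ Ω := subset_closure.trans hΩ₁_sub
  have hΩ₁_bdd : Bornology.IsBounded Ω₁ := hΩ_bdd.subset hsub
  have := isFiniteMeasure_surfaceMeasure_frontier hΩ_open hΩ_bdd hΩ_lip
  have := isFiniteMeasure_surfaceMeasure_frontier hΩ₁_open hΩ₁_bdd hΩ₁_lip
  have : IsFiniteMeasure (volume.restrict Ω) :=
    ⟨by rw [Measure.restrict_apply_univ]; exact hΩ_bdd.measure_lt_top⟩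
  have hcl : ∀ {V : Set (EuclideanSpace ℝ (Fin d))}, Bornology.IsBounded V →
      IsCompact (closure V) := fun h =>
    Metric.isCompact_of_isClosed_isBounded isClosed_closure h.closure
  have haeΩ : ∀ᵐ x ∂volume.restrict Ω, x ∈ closure Ω :=
    (ae_restrict_mem hΩ_open.measurableSet).mono fun x hx => subset_closure hx
  have haeF : ∀ V : Set (EuclideanSpace ℝ (Fin d)),
      ∀ᵐ x ∂surfaceMeasure (frontier V), x ∈ closure V := fun V =>
    (ae_restrict_mem isClosed_frontier.measurableSet).mono fun x hx => frontier_subset_closure hx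
  have hμ : ∀ φ : EuclideanSpace ℝ (Fin d) → ℝ, ContDiff ℝ ∞ φ → MemLp φ 2 (volume.restrict Ω) :=
    fun φ hφ => memLp_two_of_continuous (hcl hΩ_bdd) haeΩ hφ.continuous
  have hgr : ∀ φ : EuclideanSpace ℝ (Fin d) → ℝ, ContDiff ℝ ∞ φ →
      MemLp (gradient φ) 2 (volume.restrict Ω) := fun φ hφ =>
    memLp_two_of_continuous (hcl hΩ_bdd) haeΩ
      (ContDiff.continuous_gradient (hφ.of_le (by simp)))
  have hΓ : ∀ φ : EuclideanSpace ℝ (Fin d) → ℝ, ContDiff ℝ ∞ φ →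
      MemLp φ 2 (surfaceMeasure (frontier Ω₁)) :=
    fun φ hφ => memLp_two_of_continuous (hcl hΩ₁_bdd) (haeF Ω₁) hφ.continuous
  have hb : ∀ φ : EuclideanSpace ℝ (Fin d) → ℝ, ContDiff ℝ ∞ φ →
      MemLp φ 2 (surfaceMeasure (frontier Ω)) :=
    fun φ hφ => memLp_two_of_continuous (hcl hΩ_bdd) (haeF Ω) hφ.continuous
  obtain ⟨C₁, hC₁⟩ := hΩ₁_lip.exists_lintegral_frontier_le hΩ₁_open hΩ₁_bdd
  obtain ⟨C₂, hC₂⟩ := hΩ_lip.exists_lintegral_frontier_le hΩ_open hΩ_bdd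
  have hT₁ := norm_toL2_le_sobolevMap hμ hgr hΓ (C := C₁) fun φ hφ => (hC₁ φ hφ).trans <|
    mul_le_mul_right (add_le_add (lintegral_mono_set hsub) (lintegral_mono_set hsub)) _
  have hT₂ := norm_toL2_le_sobolevMap hμ hgr hb hC₂
  have hΓne : (frontier Ω₁).Nonempty := by
    have : Nonempty (Fin d) := ⟨⟨0, by omega⟩⟩
    refine nonempty_frontier_iff.2 ⟨hΩ₁_ne, fun h => ?_⟩
    exact NormedSpace.unbounded_univ ℝ (EuclideanSpace ℝ (Fin d)) (h ▸ hΩ₁_bdd)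
  obtain ⟨C, hC⟩ := energyControlled_surfaceMeasure_frontier hΩ_open hΩ_conn.isPreconnected
    hΩ_bdd hΩ_lip hΩ₁_open hsub hΩ₁_lip hΓne
  have hP : ∀ φ, ‖toL2 _ hμ φ‖ ^ 2 ≤ (C : ℝ) * (‖gradL2 _ hgr φ‖ ^ 2 + ‖toL2 _ hΓ φ‖ ^ 2) := by
    intro φ
    have hφ : ContDiff ℝ ∞ (φ : EuclideanSpace ℝ (Fin d) → ℝ) := φ.2
    have h := hC φ (hφ.of_le (by simp))
    rw [← ofReal_norm_toL2_sq hΓ, ← ofReal_norm_toL2_sq hμ, ← ofReal_norm_gradL2_sq hgr] at h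
    exact le_of_ofReal_le_coe_mul (by positivity) (by positivity) h
  have hσ_mem : MemLp (conductivity Ω Ω₁ σ₁ σ₂) ∞ (volume.restrict Ω) :=
    memLp_top_of_bound
      (measurable_conductivity σ₁ σ₂ hΩ_open hΩ₁_open).aestronglyMeasurable (σ₁ + σ₂)
      (Eventually.of_forall fun x => abs_conductivity_le hσ₁.le hσ₂.le x)
  set m : Lp ℝ ∞ (volume.restrict Ω) := hσ_mem.toLp _
  have hm : ∀ᵐ x ∂volume.restrict Ω, m x = conductivity Ω Ω₁ σ₁ σ₂ x := hσ_mem.coeFn_toLp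
  have hΓnull : volume (frontier Ω₁) = 0 :=
    volume_eq_zero_of_surfaceMeasure_ne_top (by omega) (measure_ne_top _ _)
  have hcm : ∀ᵐ x ∂volume.restrict Ω, min σ₁ σ₂ ≤ m x := by
    filter_upwards [hm, ae_restrict_mem hΩ_open.measurableSet,
      ae_restrict_of_ae (measure_eq_zero_iff_ae_notMem.1 hΓnull)] with x hx hxΩ hxΓ
    rw [hx]
    exact min_le_conductivity hΩ₁_open hxΩ hxΓ
  have hσ : 0 < min σ₁ σ₂ := lt_min hσ₁ hσ₂
  have hex : ∀ γ ∈ LInftyPos (frontier Ω₁), ∀ g : Lp ℝ 2 (surfaceMeasure (frontier Ω)),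
      ∃ u : SobolevH1 Ω, IsRobinSolution Ω Ω₁ σ₁ σ₂ γ g u ∧
        HasTrace (frontier Ω) u (neumannToDirichlet Ω Ω₁ σ₁ σ₂ γ g) := fun γ hγ g =>
    exists_robinSolution_neumannToDirichlet
      (exists_isRobinSolution hμ hgr hΓ hb hT₂ C.2 hP hm hσ hcm hγ g)
  have main : ∀ γ₁ ∈ LInftyPos (frontier Ω₁), ∀ γ₂ ∈ LInftyPos (frontier Ω₁),
      ∀ (g : Lp ℝ 2 (surfaceMeasure (frontier Ω))) (u₂ : SobolevH1 Ω)
        (u₂Γ : Lp ℝ 2 (surfaceMeasure (frontier Ω₁))),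
      IsRobinSolution Ω Ω₁ σ₁ σ₂ γ₂ g u₂ → HasTrace (frontier Ω₁) u₂ u₂Γ →
      (∫ x, g x * (neumannToDirichlet Ω Ω₁ σ₁ σ₂ γ₂ g x
            - neumannToDirichlet Ω Ω₁ σ₁ σ₂ γ₁ g x) ∂surfaceMeasure (frontier Ω)
          ≤ ∫ x, (γ₁ x - γ₂ x) * u₂Γ x ^ 2 ∂surfaceMeasure (frontier Ω₁)) ∧
      (∫ x, (γ₂ x - γ₂ x ^ 2 / γ₁ x) * u₂Γ x ^ 2 ∂surfaceMeasure (frontier Ω₁)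
          ≤ ∫ x, g x * (neumannToDirichlet Ω Ω₁ σ₁ σ₂ γ₂ g x
            - neumannToDirichlet Ω Ω₁ σ₁ σ₂ γ₁ g x) ∂surfaceMeasure (frontier Ω)) := by
    intro γ₁ hγ₁ γ₂ hγ₂ g u₂ a hu₂ ha
    obtain ⟨v, hv, hvt⟩ := hex γ₂ hγ₂ g
    obtain ⟨u₁, hu₁, hu₁t⟩ := hex γ₁ hγ₁ g
    obtain ⟨a', ha', hu₂w⟩ := (isRobinSolution_iff hm).1 hu₂
    obtain rfl := HasTrace.unique hT₁ ha ha'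
    obtain ⟨vΓ, hvΓ, hvw⟩ := (isRobinSolution_iff hm).1 hv
    obtain ⟨b, hbΓ, hu₁w⟩ := (isRobinSolution_iff hm).1 hu₁
    obtain ⟨t₂, ht₂⟩ := ha.exists_trace hT₂ hΓ
    obtain ⟨c₁, hc₁, hγ₁c⟩ := hγ₁
    -- `u₂` and the solution `v` chosen for `γ₂` give the same boundary functional by symmetry.
    have hv2 : inner ℝ g t₂ = inner ℝ g (neumannToDirichlet Ω Ω₁ σ₁ σ₂ γ₂ g) := by
      rw [← hvw u₂ a t₂ ha ht₂, ← hu₂w v vΓ _ hvΓ hvt, weightedForm_comm m,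
        weightedForm_comm γ₂]
    have e22 := hu₂w u₂ a t₂ ha ht₂
    have e21 := hu₂w u₁ b _ hbΓ hu₁t
    have e11 := hu₁w u₁ b _ hbΓ hu₁t
    have e12 := hu₁w u₂ a t₂ ha ht₂
    rw [weightedForm_comm m, weightedForm_comm γ₁] at e12
    rw [integral_mul_sub_eq_inner, ← hv2]
    have hS := weightedForm_self_nonneg hσ.le hcm (u₂.grad - u₁.grad)
    rw [weightedForm_sub_sub] at hS
    constructor
    · have hG := weightedForm_self_nonneg hc₁.le hγ₁c (a - b)
      rw [weightedForm_sub_sub] at hG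
      rw [integral_sub_mul_sq_eq]
      linarith
    · have hG := integral_sub_sq_div_mul_sq_le γ₂ hc₁ hγ₁c a b
      linarith
  refine ⟨main, fun γ₁ hγ₁ γ₂ hγ₂ hle g => ?_⟩
  obtain ⟨u₂, hu₂, -⟩ := hex γ₂ hγ₂ g
  obtain ⟨a, ha, -⟩ := id hu₂
  have h := (main γ₁ hγ₁ γ₂ hγ₂ g u₂ a hu₂ ha).1
  have hneg : ∫ x, (γ₁ x - γ₂ x) * a x ^ 2 ∂surfaceMeasure (frontier Ω₁) ≤ 0 := by
    refine integral_nonpos_of_ae ?_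
    filter_upwards [Lp.coeFn_le _ _ |>.2 hle] with x hx
    exact mul_nonpos_of_nonpos_of_nonneg (sub_nonpos.2 hx) (sq_nonneg _)
  rw [integral_mul_sub_eq_inner] at h
  rw [integral_mul_eq_inner, integral_mul_eq_inner]
  linarith
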